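/- Let $n\in\mathbb N$, let $U\subset\mathbb R^n$ be open, let $f\in C^2(U\times\mathbb R,\mathbb R^n)$, and let $\Lambda\in C^2(\mathbb R,(\lambda_-,\lambda_+))$ be a parameter shift, i.e. $\Lambda(s)\to\lambda_\pm$ and $\Lambda'(s)\to 0$ as $s\to\pm\infty$. An attracting equilibrium of $\dot x=f(x,\lambda)$ is a point $p\in U$ with $f(p,\lambda)=0$ such that all eigenvalues of $\partial_xf(p,\lambda)$ have negative real part; its basin $\mathbb B(p,\lambda)$ is the set of points of $U$ whose forward solution under $\dot x=f(x,\lambda)$ exists for all $t\ge 0$, stays in $U$ and converges to $p$. A stable path $(X(s),\Lambda(s))$ is a continuous $X:\mathbb R\to U$ such that $X(s)$ is an attracting equilibrium of $\dot x=f(x,\Lambda(s))$ for every $s\in\mathbb R$. It is forward basin stable (FBS) if $\overline{\{X(u):u<s\}}\subset\mathbb B(X(s),\Lambda(s))$ for all $s\in\mathbb R$. Let $(X(s),\Lambda(s))$ be a stable path such that the limits $X_\pm=\lim_{s\to\pm\infty}X(s)$ exist, $X_-$ being an attracting equilibrium for $\lambda=\lambda_-$. For a parameter shift $\Lambda$ and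 $r>0$, we say that there is R-tipping away from $X_-$ at rate $r$ if $\dot x=f(x,\Lambda(rt))$ has a unique maximal solution $x^r$ in $U$ that is defined for all sufficiently negative $t$ and satisfies $x^r(t)\to X_-$ as $t\to-\infty$ (the local pullback attractor to $X_-$), and it is not the case that $x^r$ is defined for all $t$ with $x^r(t)\to X_+$ as $t\to+\infty$. 1. Suppose that there is a stable path $(Y(s),\Lambda(s))$ whose limit $Y_+=\lim_{s\to+\infty}Y(s)$ exists, is an attracting equilibrium for $\lambda=\lambda_+$ and satisfies $Y_+\ne X_+$, and that there are $u<v$ with $X(u)\in\mathbb B(Y(v),\Lambda(v))$. Then $(X(s),\Lambda(s))$ is not FBS, and there is an increasing $C^2$ bijection $\sigma:\mathbb R\to\mathbb R$ with $\sigma'>0$ such that $\tilde\Lambda=\Lambda\circ\sigma$ is again a parameter shift from $\lambda_-$ to $\lambda_+$ and, for $\tilde\Lambda$ in place of $\Lambda$, there is R-tipping away from $X_-$ at some rate $r>0$. 2. Suppose that there is an attracting equilibrium $Y_+\ne X_+$ for $\lambda=\lambda_+$ with $X_-\in\mathbb B(Y_+,\lambda_+)$. Then $(X(s),\Lambda(s))$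 is not FBS, and there is $r_0>0$ such that for the given $\Lambda$ there is R-tipping away from $X_-$ at every rate $r>r_0$. -/

import Mathlib

open Set Filter Topology

namespace RateTipping

/-- `ℝⁿ` with its Euclidean norm. -/
abbrev Space (n : ℕ) : Type := EuclideanSpace ℝ (Fin n)

/-- `Λ` is a parameter shift from `lm` to `lp`: a `C²` function `ℝ → (lm, lp)` that tends to
`lm` at `-∞` and to `lp` at `+∞`, with derivative tending to `0` at both ends. -/
structure IsParameterShift (Λ : ℝ → ℝ) (lm lp : ℝ) : Prop where
  contDiff : ContDiff ℝ 2 Λ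
  mem_Ioo : ∀ s, Λ s ∈ Ioo lm lp
  tendsto_atBot : Tendsto Λ atBot (𝓝 lm)
  tendsto_atTop : Tendsto Λ atTop (𝓝 lp)
  deriv_atBot : Tendsto (deriv Λ) atBot (𝓝 0)
  deriv_atTop : Tendsto (deriv Λ) atTop (𝓝 0)

/-- `p ∈ U` is a (linearly) attracting equilibrium of `ẋ = f(x, l)`: `f(p, l) = 0` and every
complex eigenvalue of the Jacobian `∂ₓ f(p, l)` (every complex root of its characteristic
polynomial) has negative real part. -/
structure IsAttractingEquilibrium {n : ℕ} (U : Set (Space n)) (f : Space n → ℝ → Space n)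
    (l : ℝ) (p : Space n) : Prop where
  mem : p ∈ U
  eq_zero : f p l = 0
  re_neg : ∀ μ : ℂ,
    Polynomial.aeval μ
      (LinearMap.charpoly (fderiv ℝ (fun x => f x l) p : Space n →ₗ[ℝ] Space n)) = 0 →
    μ.re < 0

/-- The basin of attraction of `p` for the autonomous system `ẋ = f(x, l)` on `U`: the initial
points whose forward solution exists for all `t ≥ 0`, stays in `U` and converges to `p`. -/
def basin {n : ℕ} (U : Set (Space n)) (f : Space n → ℝ → Space n) (l : ℝ) (p : Space n) :
    Set (Space n) :=
  {a | ∃ x : ℝ → Space n, x 0 = a ∧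
    (∀ t : ℝ, 0 ≤ t → x t ∈ U ∧ HasDerivWithinAt x (f (x t) l) (Ici 0) t) ∧
    Tendsto x atTop (𝓝 p)}

/-- `(X(s), Λ(s))` is a stable path: `X` is continuous and each `X s` is an attracting equilibrium
of `ẋ = f(x, Λ s)`. -/
structure IsStablePath {n : ℕ} (U : Set (Space n)) (f : Space n → ℝ → Space n)
    (Λ : ℝ → ℝ) (X : ℝ → Space n) : Prop where
  continuous : Continuous X
  attracting : ∀ s, IsAttractingEquilibrium U f (Λ s) (X s)

/-- Forward basin stability of the path `(X(s), Λ(s))`. -/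
def IsForwardBasinStable {n : ℕ} (U : Set (Space n)) (f : Space n → ℝ → Space n)
    (Λ : ℝ → ℝ) (X : ℝ → Space n) : Prop :=
  ∀ s : ℝ, closure (X '' Iio s) ⊆ basin U f (Λ s) (X s)

/-- `x` solves `ẋ = f(x, Λ(r t))` in `U` on the time interval `(-∞, b)`, where `b ≤ +∞`. -/
def IsTrajectory {n : ℕ} (U : Set (Space n)) (f : Space n → ℝ → Space n)
    (Λ : ℝ → ℝ) (r : ℝ) (b : EReal) (x : ℝ → Space n) : Prop :=
  ∀ t : ℝ, (t : EReal) < b → x t ∈ U ∧ HasDerivAt x (f (x t) (Λ (r * t))) t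

/-- `x`, on its maximal interval of existence `(-∞, b)`, is the local pullback attractor to `Xm`
at rate `r`: the unique trajectory of `ẋ = f(x, Λ(r t))` that tends to `Xm` as `t → -∞`.
Maximality and uniqueness: every trajectory on some `(-∞, c)` that tends to `Xm` as `t → -∞`
is a restriction of `x`. -/
structure IsPullbackAttractor {n : ℕ} (U : Set (Space n)) (f : Space n → ℝ → Space n)
    (Λ : ℝ → ℝ) (r : ℝ) (Xm : Space n) (b : EReal) (x : ℝ → Space n) : Prop where
  bot_lt : ⊥ < b
  trajectory : IsTrajectory U f Λ r b x
  tendsto_atBot : Tendsto x atBot (𝓝 Xm)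
  unique : ∀ (c : EReal) (y : ℝ → Space n), IsTrajectory U f Λ r c y →
    Tendsto y atBot (𝓝 Xm) → c ≤ b ∧ ∀ t : ℝ, (t : EReal) < c → y t = x t

/-- R-tipping away from `Xm` at rate `r`, for a path ending at `Xp`: the local pullback attractor
to `Xm` exists (and is unique), and it does not converge to `Xp` as `t → +∞` (in particular this
is so when it is not defined for all times). -/
def RTips {n : ℕ} (U : Set (Space n)) (f : Space n → ℝ → Space n)
    (Λ : ℝ → ℝ) (r : ℝ) (Xm Xp : Space n) : Prop :=
  ∃ (b : EReal) (x : ℝ → Space n), IsPullbackAttractor U f Λ r Xm b x ∧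
    ¬ (b = ⊤ ∧ Tendsto x atTop (𝓝 Xp))

/-- An increasing `C²` reparametrization of the real line, with positive derivative. -/
structure IsReparametrization (σ : ℝ → ℝ) : Prop where
  contDiff : ContDiff ℝ 2 σ
  deriv_pos : ∀ s, 0 < deriv σ s
  tendsto_atBot : Tendsto σ atBot atBot
  tendsto_atTop : Tendsto σ atTop atTop

end RateTipping

/-! An attracting equilibrium X_- always has a unique local pullback attractor
(`exists_isPullbackAttractor`). Without R-tipping it would be a global solution joining X_- to X_+
(`exists_connection_of_not_rTips`). Tipping thus follows once such a solution is shown to stay, from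
some time on, within half the distance from Y_+ to X_+ of Y_+.

For a fast shift with X_- in the basin of Y_+, the solution is near X_- while the parameter is near
λ_-, and the passage to the neighbourhood of λ_+ is too short for it to move far. It is then
captured by Y_+ (`IsAttractingEquilibrium.capture`). For X(u) in the basin of Y(v), the
reparametrization `slowFast` has speed ε except for a jump from u to v lasting time ε. As ε → 0 the
solution tracks X adiabatically up to u, hardly moves during the jump, falls into the basin of Y(v),
and tracks Y until it is trapped near Y_+.

Forward basin stability fails for softer reasons. In the first case it would put X(u) in the basins
of both X(v) and Y(v), so the two paths meet, hence coincide, hence have the same limit. In the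
second it would put X_- in the basin of every X(s), while for large s the frozen flow carries X_-
close to Y_+.

The analytic engine is a quadratic form ⟪P x, x⟫ for which all fields f(·, λ), λ near l, contract
uniformly near an attracting equilibrium (`IsLocalContraction`). It gives trapping, relaxation to
nearby equilibria and uniqueness of solutions in the past. Elsewhere f is replaced by a compactly
supported Lipschitz field near the compact set in play. -/

namespace RateTipping

open scoped InnerProductSpace

/-! ### Hurwitz matrices and Lyapunov inner products -/

section Hurwitz

attribute [local instance] Matrix.linftyOpNormedRing Matrix.linftyOpNormedAlgebra

/-- Powers of a complex matrix whose eigenvalues lie in the open unit disc tend to zero. -/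
theorem tendsto_matrix_pow_zero {n : ℕ} [NeZero n] (M : Matrix (Fin n) (Fin n) ℂ)
    (h : ∀ z ∈ spectrum ℂ M, ‖z‖ < 1) : Tendsto (fun k => M ^ k) atTop (𝓝 0) := by
  have hr : spectralRadius ℂ M < ((1 : NNReal) : ENNReal) :=
    spectrum.spectralRadius_lt_of_forall_lt M fun z hz => by
      exact_mod_cast h z hz
  obtain ⟨q, hq1, hq2⟩ := exists_between hr
  lift q to NNReal using (hq2.trans ENNReal.coe_lt_top).ne
  have hq2' : q < 1 := by exact_mod_cast hq2
  -- Gelfand's formula: ‖M ^ k‖ ^ (1 / k) is eventually below q < 1, so the powers are dominated by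
  -- a geometric sequence.
  have hev := (spectrum.pow_nnnorm_pow_one_div_tendsto_nhds_spectralRadius M).eventually
    (gt_mem_nhds hq1)
  refine tendsto_zero_iff_norm_tendsto_zero.2 ?_
  refine squeeze_zero' (Eventually.of_forall fun _ => norm_nonneg _) (g := fun k => (q : ℝ) ^ k) ?_
    (tendsto_pow_atTop_nhds_zero_of_lt_one q.2 hq2')
  filter_upwards [hev, eventually_gt_atTop 0] with k hk hk0
  have hk0' : (0 : ℝ) < k := by exact_mod_cast hk0
  have h1 := ENNReal.rpow_le_rpow hk.le hk0'.le
  rw [← ENNReal.rpow_mul, one_div_mul_cancel hk0'.ne', ENNReal.rpow_one, ENNReal.rpow_natCast] at h1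
  exact_mod_cast h1

/-- If all complex eigenvalues of a real endomorphism have negative real part, then the powers of
`1 + h A` tend to zero for some `h > 0`. -/
theorem exists_tendsto_pow_zero {n : ℕ} (A : Space n →L[ℝ] Space n)
    (hA : ∀ μ : ℂ, Polynomial.aeval μ (LinearMap.charpoly (A : Space n →ₗ[ℝ] Space n)) = 0 →
      μ.re < 0) :
    ∃ h : ℝ, 0 < h ∧ Tendsto (fun k : ℕ => (1 + h • A) ^ k) atTop (𝓝 0) := by
  rcases Nat.eq_zero_or_pos n with rfl | hn
  · refine ⟨1, one_pos, ?_⟩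
    have : ∀ B : Space 0 →L[ℝ] Space 0, B = 0 := fun B => by ext x i; exact i.elim0
    simp only [this]
    exact tendsto_const_nhds
  have : NeZero n := ⟨hn.ne'⟩
  let b := (EuclideanSpace.basisFun (Fin n) ℝ).toBasis
  let φ : (Space n →ₗ[ℝ] Space n) ≃ₐ[ℝ] Matrix (Fin n) (Fin n) ℝ := LinearMap.toMatrixAlgEquiv b
  let M : Matrix (Fin n) (Fin n) ℝ := φ A
  let Mc : Matrix (Fin n) (Fin n) ℂ := M.map (algebraMap ℝ ℂ)
  have hspec : ∀ z ∈ spectrum ℂ Mc, z.re < 0 := by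
    intro z hz
    rw [Matrix.mem_spectrum_iff_isRoot_charpoly] at hz
    apply hA
    have h1 : Mc.charpoly = M.charpoly.map (algebraMap ℝ ℂ) := Matrix.charpoly_map M (algebraMap ℝ ℂ)
    rw [h1] at hz
    have h2 : M.charpoly = LinearMap.charpoly (A : Space n →ₗ[ℝ] Space n) :=
      LinearMap.charpoly_toMatrix _ b
    rw [← h2, Polynomial.aeval_def, ← Polynomial.eval_map]
    exact hz
  have hfin : (spectrum ℂ Mc).Finite := Matrix.finite_spectrum Mc
  -- |1 + hz|² = 1 + 2h Re z + h²|z|² is below 1 as soon as 0 < h < -Re z / |z|², and the spectrum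
  -- is finite, so one h serves all eigenvalues.
  have hev : ∀ᶠ h : ℝ in 𝓝[>] 0, ∀ z ∈ spectrum ℂ Mc, ‖1 + (h : ℂ) * z‖ < 1 := by
    rw [hfin.eventually_all]
    intro z hz
    have hz' := hspec z hz
    have hz0 : 0 < ‖z‖ ^ 2 := by
      have : z ≠ 0 := by rintro rfl; simp at hz'
      positivity
    have hpos : 0 < -z.re / ‖z‖ ^ 2 := div_pos (by linarith) hz0
    filter_upwards [Ioo_mem_nhdsGT hpos] with h hh
    have h3 := (lt_div_iff₀ hz0).1 hh.2
    rw [← sq_lt_one_iff₀ (norm_nonneg _), Complex.sq_norm, Complex.normSq_apply]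
    rw [Complex.sq_norm, Complex.normSq_apply] at h3
    simp only [Complex.add_re, Complex.one_re, Complex.mul_re, Complex.ofReal_re, Complex.ofReal_im,
      Complex.add_im, Complex.one_im, Complex.mul_im]
    nlinarith [hh.1]
  obtain ⟨h, hh, h0⟩ := (hev.and self_mem_nhdsWithin).exists
  refine ⟨h, h0, ?_⟩
  have hc : Tendsto (fun k : ℕ => (1 + (h : ℂ) • Mc) ^ k) atTop (𝓝 0) := by
    apply tendsto_matrix_pow_zero
    intro w hw
    have hne : (h : ℂ) ≠ 0 := by exact_mod_cast h0.ne'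
    have h4 : (w - 1) / h ∈ spectrum ℂ Mc := by
      rw [spectrum.mem_iff] at hw ⊢
      intro hu
      apply hw
      have : algebraMap ℂ (Matrix (Fin n) (Fin n) ℂ) w - (1 + (h : ℂ) • Mc) =
          (Units.mk0 (h : ℂ) hne) • (algebraMap ℂ (Matrix (Fin n) (Fin n) ℂ) ((w - 1) / h) - Mc) := by
        rw [Units.smul_mk0, smul_sub, Algebra.algebraMap_eq_smul_one, Algebra.algebraMap_eq_smul_one,
          smul_smul, mul_div_cancel₀ _ hne, sub_smul, one_smul]
        abel
      rw [this]
      exact hu.smul _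
    have h5 := hh _ h4
    rwa [mul_div_cancel₀ _ hne, add_sub_cancel] at h5
  have hr : Tendsto (fun k : ℕ => (1 + h • M) ^ k) atTop (𝓝 0) := by
    have hcont : Continuous fun N : Matrix (Fin n) (Fin n) ℂ => N.map Complex.re :=
      Continuous.matrix_map continuous_id Complex.continuous_re
    have h6 := (hcont.tendsto 0).comp hc
    have h7 : (0 : Matrix (Fin n) (Fin n) ℂ).map Complex.re = 0 := by ext i j; simp
    rw [h7] at h6
    refine h6.congr fun k => ?_
    have h8 : (1 + (h : ℂ) • Mc) = (1 + h • M).map (algebraMap ℝ ℂ) := by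
      ext i j
      by_cases hij : i = j <;> simp [Mc, hij]
    simp only [Function.comp_apply]
    rw [h8, ← RingHom.mapMatrix_apply, ← map_pow, RingHom.mapMatrix_apply]
    ext i j
    simp
  let ψ : Matrix (Fin n) (Fin n) ℝ →ₗ[ℝ] (Space n →L[ℝ] Space n) :=
    (LinearMap.toContinuousLinearMap : (Space n →ₗ[ℝ] Space n) ≃ₗ[ℝ] _).toLinearMap ∘ₗ
      φ.symm.toLinearMap
  have hψ : Continuous ψ := ψ.continuous_of_finiteDimensional
  have h9 := (hψ.tendsto 0).comp hr
  rw [map_zero] at h9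
  refine h9.congr fun k => ?_
  have h10 : ∀ k : ℕ, (φ.symm ((1 + h • M) ^ k)) = (((1 + h • A) ^ k : Space n →L[ℝ] Space n) :
      Space n →ₗ[ℝ] Space n) := by
    intro k
    have e1 : φ.symm (1 + h • M) = ((1 + h • A : Space n →L[ℝ] Space n) : Space n →ₗ[ℝ] Space n) := by
      rw [map_add, map_one, map_smul, AlgEquiv.symm_apply_apply]; rfl
    rw [map_pow, e1]
    ext x : 1
    simp
  ext x : 1
  exact LinearMap.congr_fun (h10 k) x

end Hurwitz

/-- Lyapunov's theorem: a Hurwitz endomorphism is strictly dissipative for some inner product. -/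
theorem exists_lyapunov {n : ℕ} (A : Space n →L[ℝ] Space n)
    (hA : ∀ μ : ℂ, Polynomial.aeval μ (LinearMap.charpoly (A : Space n →ₗ[ℝ] Space n)) = 0 →
      μ.re < 0) :
    ∃ (P : Space n →L[ℝ] Space n) (c : ℝ), 0 < c ∧ (∀ x y, ⟪P x, y⟫_ℝ = ⟪x, P y⟫_ℝ) ∧
      (∀ x, ‖x‖ ^ 2 ≤ ⟪P x, x⟫_ℝ) ∧ ∀ x, ⟪P x, A x⟫_ℝ ≤ -c * ‖x‖ ^ 2 := by
  obtain ⟨h, h0, hlim⟩ := exists_tendsto_pow_zero A hA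
  set B : Space n →L[ℝ] Space n := 1 + h • A with hB
  have hev : ∀ᶠ k : ℕ in atTop, ‖B ^ k‖ < 1 / 2 :=
    (tendsto_zero_iff_norm_tendsto_zero.1 hlim).eventually
      (gt_mem_nhds (by norm_num : (0 : ℝ) < 1 / 2))
  obtain ⟨N, hN, hN0⟩ := (hev.and (eventually_gt_atTop 0)).exists
  -- A truncated discrete Lyapunov sum: V(x) = ⟪P x, x⟫ telescopes to V(Bx) = V(x) - ‖x‖² + ‖B ^ N
  -- x‖², and ‖B ^ N‖ < 1/2 makes the drop at least (3/4)‖x‖². Expanding V(x + h A x) and discarding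
  -- the nonnegative h² term leaves 2h ⟪P x, A x⟫ ≤ -(3/4)‖x‖², whence the constant 3 / (8h).
  let P : Space n →L[ℝ] Space n :=
    ∑ k ∈ Finset.range N, (ContinuousLinearMap.adjoint (B ^ k)) ∘L (B ^ k)
  have hP : ∀ x y, ⟪P x, y⟫_ℝ = ∑ k ∈ Finset.range N, ⟪(B ^ k) x, (B ^ k) y⟫_ℝ := by
    intro x y
    simp [P, sum_inner, ContinuousLinearMap.adjoint_inner_left]
  have hsymm : ∀ x y, ⟪P x, y⟫_ℝ = ⟪x, P y⟫_ℝ := by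
    intro x y
    rw [real_inner_comm (P y) x, hP, hP]
    exact Finset.sum_congr rfl fun k _ => real_inner_comm _ _
  refine ⟨P, 3 / (8 * h), by positivity, hsymm, ?_, ?_⟩
  · intro x
    rw [hP]
    have := Finset.single_le_sum (f := fun k => ⟪(B ^ k) x, (B ^ k) x⟫_ℝ)
      (fun k _ => real_inner_self_nonneg) (Finset.mem_range.2 hN0)
    simpa [real_inner_self_eq_norm_sq] using this
  · intro x
    have hstep : ⟪P (B x), B x⟫_ℝ = ⟪P x, x⟫_ℝ - ‖x‖ ^ 2 + ‖(B ^ N) x‖ ^ 2 := by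
      have e : ∀ k : ℕ, (B ^ k) (B x) = (B ^ (k + 1)) x := fun k => by
        rw [pow_succ]; rfl
      rw [hP, hP]
      simp only [real_inner_self_eq_norm_sq, e]
      have := Finset.sum_range_succ' (fun k => ‖(B ^ k) x‖ ^ 2) N
      rw [Finset.sum_range_succ] at this
      simp only [pow_zero, one_apply_eq_self] at this
      linarith
    have hBN : ‖(B ^ N) x‖ ≤ 1 / 2 * ‖x‖ :=
      ((B ^ N).le_opNorm x).trans (mul_le_mul_of_nonneg_right hN.le (norm_nonneg _))
    have hBx : B x = x + h • A x := by simp [hB]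
    have hexp : ⟪P (B x), B x⟫_ℝ =
        ⟪P x, x⟫_ℝ + 2 * h * ⟪P x, A x⟫_ℝ + h ^ 2 * ⟪P (A x), A x⟫_ℝ := by
      rw [hBx, map_add, map_smul, inner_add_left, inner_add_right, inner_add_right,
        inner_smul_left, inner_smul_right, inner_smul_left, inner_smul_right, hsymm (A x) x,
        real_inner_comm (P x) (A x)]
      simp only [conj_trivial]
      ring
    have hnn : 0 ≤ ⟪P (A x), A x⟫_ℝ := by
      rw [hP]; exact Finset.sum_nonneg fun k _ => real_inner_self_nonneg
    have hsq : ‖(B ^ N) x‖ ^ 2 ≤ 1 / 4 * ‖x‖ ^ 2 := by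
      calc _ ≤ (1 / 2 * ‖x‖) ^ 2 := by gcongr
        _ = _ := by ring
    have hkey : 2 * h * ⟪P x, A x⟫_ℝ ≤ -(3 / 4) * ‖x‖ ^ 2 := by
      have := mul_nonneg (sq_nonneg h) hnn
      linarith
    have : ⟪P x, A x⟫_ℝ = (2 * h * ⟪P x, A x⟫_ℝ) / (2 * h) := by field_simp
    rw [this, div_le_iff₀ (by positivity)]
    calc _ ≤ _ := hkey
      _ = _ := by field_simp; ring

/-! ### Uniform contraction near an attracting equilibrium -/

/-- `x` is a (right-differentiable) solution of `ẋ = f(x, μ(t))` on `[a, b]`. -/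
structure SolvesOn {n : ℕ} (f : Space n → ℝ → Space n) (μ : ℝ → ℝ) (a b : ℝ)
    (x : ℝ → Space n) : Prop where
  continuousOn : ContinuousOn x (Icc a b)
  hasDeriv : ∀ t ∈ Ico a b, HasDerivWithinAt x (f (x t) (μ t)) (Ici t) t

theorem SolvesOn.mono {n : ℕ} {f : Space n → ℝ → Space n} {μ : ℝ → ℝ} {a b a' b' : ℝ}
    {x : ℝ → Space n} (h : SolvesOn f μ a b x) (ha : a ≤ a') (hb : b' ≤ b) :
    SolvesOn f μ a' b' x :=
  ⟨h.continuousOn.mono (Icc_subset_Icc ha hb),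
    fun t ht => h.hasDeriv t ⟨ha.trans ht.1, ht.2.trans_le hb⟩⟩

theorem SolvesOn.of_hasDerivAt {n : ℕ} {f : Space n → ℝ → Space n} {μ : ℝ → ℝ} {a b : ℝ}
    {x : ℝ → Space n} (h : ∀ t ∈ Icc a b, HasDerivAt x (f (x t) (μ t)) t) :
    SolvesOn f μ a b x :=
  ⟨fun t ht => (h t ht).continuousAt.continuousWithinAt,
    fun t ht => (h t (Ico_subset_Icc_self ht)).hasDerivWithinAt⟩

theorem SolvesOn.congr_param {n : ℕ} {f : Space n → ℝ → Space n} {μ ν : ℝ → ℝ} {a b : ℝ}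
    {x : ℝ → Space n} (h : SolvesOn f μ a b x) (hμ : ∀ t ∈ Ico a b, μ t = ν t) :
    SolvesOn f ν a b x :=
  ⟨h.continuousOn, fun t ht => hμ t ht ▸ h.hasDeriv t ht⟩

/-- Near `(p, l)` the vector fields `f(·, λ)` are uniformly contracting for the inner product
`⟪P x, y⟫`. -/
structure IsLocalContraction {n : ℕ} (f : Space n → ℝ → Space n) (l : ℝ) (p : Space n)
    (P : Space n →L[ℝ] Space n) (c ρ : ℝ) : Prop where
  c_pos : 0 < c
  radius_pos : 0 < ρ
  symm : ∀ x y, ⟪P x, y⟫_ℝ = ⟪x, P y⟫_ℝ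
  norm_sq_le : ∀ x, ‖x‖ ^ 2 ≤ ⟪P x, x⟫_ℝ
  contract : ∀ m, |m - l| ≤ ρ → ∀ x y, ‖x - p‖ ≤ ρ → ‖y - p‖ ≤ ρ →
    ⟪P (x - y), f x m - f y m⟫_ℝ ≤ -c * ‖x - y‖ ^ 2

section LocalContraction

variable {n : ℕ} {U : Set (Space n)} {f : Space n → ℝ → Space n} {l : ℝ} {p : Space n}
  {P : Space n →L[ℝ] Space n} {c ρ : ℝ}

/-- Strict differentiability in (x, λ) jointly makes f x m - f y m equal to A (x - y) up to an error
small relative to ‖x - y‖, uniformly for m near l. Half of the Lyapunov rate of A absorbs this error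
after pairing with P (x - y). -/
theorem IsAttractingEquilibrium.exists_isLocalContraction (hU : IsOpen U)
    (hf : ContDiffOn ℝ 2 (fun q : Space n × ℝ => f q.1 q.2) (U ×ˢ univ))
    (hp : IsAttractingEquilibrium U f l p) :
    ∃ (P : Space n →L[ℝ] Space n) (c ρ : ℝ), IsLocalContraction f l p P c ρ := by
  have hat : ContDiffAt ℝ 2 (fun q : Space n × ℝ => f q.1 q.2) (p, l) :=
    hf.contDiffAt ((hU.prod isOpen_univ).mem_nhds ⟨hp.mem, mem_univ _⟩)
  have hstr := hat.hasStrictFDerivAt (by norm_num)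
  set F' := fderiv ℝ (fun q : Space n × ℝ => f q.1 q.2) (p, l)
  have hA : HasFDerivAt (fun x => f x l) (F' ∘L ContinuousLinearMap.inl ℝ (Space n) ℝ) p :=
    hstr.hasFDerivAt.comp (f := fun x : Space n => (x, l)) p (hasFDerivAt_prodMk_left p l)
  obtain ⟨P, c, hc, hsymm, hlow, hdiss⟩ := exists_lyapunov _ hp.re_neg
  rw [hA.fderiv] at hdiss
  have hk : 0 < c / 2 / (‖P‖ + 1) := by positivity
  have hev := hstr.isLittleO.def hk
  rw [Metric.eventually_nhds_iff] at hev
  obtain ⟨ε, hε, hball⟩ := hev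
  refine ⟨P, c / 2, ε / 2, by positivity, by positivity, hsymm, hlow, ?_⟩
  intro m hm x y hx hy
  have hmem : dist ((x, m), (y, m)) ((p, l), (p, l)) < ε := by
    have : ε / 2 < ε := by linarith
    simp only [Prod.dist_eq, max_lt_iff]
    simp only [dist_eq_norm, Real.norm_eq_abs]
    exact ⟨⟨hx.trans_lt this, hm.trans_lt this⟩, hy.trans_lt this, hm.trans_lt this⟩
  have h1 := hball hmem
  have e1 : ((x, m) : Space n × ℝ) - (y, m) = (x - y, 0) := by simp
  simp only [e1] at h1
  have e2 : ‖((x - y, 0) : Space n × ℝ)‖ = ‖x - y‖ := by simp [Prod.norm_def]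
  rw [e2] at h1
  have h2 := hdiss (x - y)
  have h3 : ⟪P (x - y), f x m - f y m⟫_ℝ =
      ⟪P (x - y), (F' ∘L ContinuousLinearMap.inl ℝ (Space n) ℝ) (x - y)⟫_ℝ +
      ⟪P (x - y), f x m - f y m - F' (x - y, 0)⟫_ℝ := by
    rw [← inner_add_right]; congr 1; simp
  have h4 : ⟪P (x - y), f x m - f y m - F' (x - y, 0)⟫_ℝ ≤ c / 2 * ‖x - y‖ ^ 2 := by
    calc _ ≤ ‖P (x - y)‖ * ‖f x m - f y m - F' (x - y, 0)‖ := real_inner_le_norm _ _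
      _ ≤ ((‖P‖ + 1) * ‖x - y‖) * (c / 2 / (‖P‖ + 1) * ‖x - y‖) := by
        gcongr
        exact (P.le_opNorm _).trans (by gcongr; linarith)
      _ = _ := by field_simp
  rw [h3]; linarith

namespace IsLocalContraction

theorem mono (h : IsLocalContraction f l p P c ρ) {ρ' : ℝ} (h0 : 0 < ρ') (hle : ρ' ≤ ρ) :
    IsLocalContraction f l p P c ρ' :=
  ⟨h.c_pos, h0, h.symm, h.norm_sq_le, fun m hm x y hx hy =>
    h.contract m (hm.trans hle) x y (hx.trans hle) (hy.trans hle)⟩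

theorem congr (h : IsLocalContraction f l p P c ρ) {g : Space n → ℝ → Space n}
    (hg : ∀ x m, ‖x - p‖ ≤ ρ → |m - l| ≤ ρ → g x m = f x m) :
    IsLocalContraction g l p P c ρ :=
  ⟨h.c_pos, h.radius_pos, h.symm, h.norm_sq_le, fun m hm x y hx hy => by
    rw [hg x m hx hm, hg y m hy hm]; exact h.contract m hm x y hx hy⟩

theorem inner_le (P : Space n →L[ℝ] Space n) (x y : Space n) :
    ⟪P x, y⟫_ℝ ≤ (‖P‖ + 1) * ‖x‖ * ‖y‖ := by
  refine (real_inner_le_norm _ _).trans ?_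
  gcongr
  exact (P.le_opNorm _).trans (by gcongr; linarith)

theorem inner_self_le (P : Space n →L[ℝ] Space n) (x : Space n) :
    ⟪P x, x⟫_ℝ ≤ (‖P‖ + 1) * ‖x‖ ^ 2 :=
  (inner_le P x x).trans_eq (by ring)

theorem hasDerivWithinAt (h : IsLocalContraction f l p P c ρ) {v : ℝ → Space n} {v' : Space n}
    {s : Set ℝ} {t : ℝ} (hv : HasDerivWithinAt v v' s t) :
    HasDerivWithinAt (fun t => ⟪P (v t), v t⟫_ℝ) (2 * ⟪P (v t), v'⟫_ℝ) s t := by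
  have h1 := (P.hasFDerivAt.comp_hasDerivWithinAt t hv).inner ℝ hv
  refine h1.congr_deriv ?_
  simp only [Function.comp_apply]
  rw [h.symm v' (v t), real_inner_comm (P (v t)) v']
  ring

/-- Two equilibria near `p` for the same parameter coincide. -/
theorem eq_of_eq_zero (h : IsLocalContraction f l p P c ρ) {m : ℝ} (hm : |m - l| ≤ ρ)
    {x y : Space n} (hx : ‖x - p‖ ≤ ρ) (hy : ‖y - p‖ ≤ ρ) (hfx : f x m = 0) (hfy : f y m = 0) :
    x = y := by
  have h1 := h.contract m hm x y hx hy
  rw [hfx, hfy, sub_zero, inner_zero_right] at h1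
  have h2 : ‖x - y‖ ^ 2 ≤ 0 := by
    by_contra hne
    push Not at hne
    nlinarith [h.c_pos]
  exact sub_eq_zero.1 (norm_eq_zero.1 (pow_eq_zero_iff two_ne_zero |>.1
    (le_antisymm h2 (sq_nonneg _))))

/-- Solutions starting near an attracting equilibrium stay near it, as long as the parameter does
not move too far. -/
theorem trap (h : IsLocalContraction f l p P c ρ) (hp : f p l = 0)
    (hcont : ContinuousAt (fun m => f p m) l) {η : ℝ} (hη : 0 < η) :
    ∃ δ > 0, ∀ (μ : ℝ → ℝ) (x : ℝ → Space n) (a b : ℝ), SolvesOn f μ a b x →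
      (∀ t ∈ Ico a b, |μ t - l| ≤ δ) → ‖x a - p‖ ≤ δ → ∀ t ∈ Icc a b, ‖x t - p‖ ≤ η := by
  set η' := min η ρ with hη'
  have hη0 : 0 < η' := lt_min hη h.radius_pos
  set M := ‖P‖ + 1 with hM
  have hM0 : 0 < M := by positivity
  have hM1 : 1 ≤ M := by simp [hM]
  have hc := h.c_pos
  have he : 0 < c * η' / (2 * M ^ 2) := by positivity
  obtain ⟨δ₁, hδ₁, hfδ⟩ := Metric.continuousAt_iff.1 hcont _ he
  refine ⟨min (min (δ₁ / 2) ρ) (η' / M), by have := h.radius_pos; positivity, ?_⟩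
  intro μ x a b hx hμ hxa t ht
  -- Barrier argument: on the level V = η'², ‖x - p‖² lies between η'² / M and η'², so the
  -- dissipation is at least c η'² / M, while the forcing f p (μ s) contributes at most half of
  -- that. Hence V cannot cross the level.
  have hV : ⟪P (x t - p), x t - p⟫_ℝ ≤ η' ^ 2 := by
    refine image_le_of_deriv_right_lt_deriv_boundary (f := fun t => ⟪P (x t - p), x t - p⟫_ℝ)
      (B := fun _ => η' ^ 2) (B' := fun _ => 0)
      (f' := fun t => 2 * ⟪P (x t - p), f (x t) (μ t)⟫_ℝ) ?_ ?_ ?_ ?_ ?_ ht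
    · have := hx.continuousOn
      fun_prop
    · intro s hs
      exact h.hasDerivWithinAt ((hx.hasDeriv s hs).sub_const p)
    · refine (inner_self_le P _).trans ?_
      have h1 : ‖x a - p‖ ≤ η' / M := hxa.trans (min_le_right _ _)
      calc M * ‖x a - p‖ ^ 2 ≤ M * (η' / M) ^ 2 := by gcongr
        _ = η' ^ 2 / M := by field_simp
        _ ≤ η' ^ 2 := div_le_self (sq_nonneg _) hM1
    · intro s; exact hasDerivAt_const s _
    · intro s hs hVs
      have hμs := hμ s hs
      have hv1 : ‖x s - p‖ ≤ η' := by
        have := h.norm_sq_le (x s - p)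
        rw [hVs] at this
        exact (sq_le_sq₀ (norm_nonneg _) hη0.le).1 this
      have hv2 : η' ^ 2 / M ≤ ‖x s - p‖ ^ 2 := by
        rw [div_le_iff₀ hM0, ← hVs]
        exact (inner_self_le P _).trans_eq (mul_comm _ _)
      have hcon := h.contract (μ s) (hμs.trans ((min_le_left _ _).trans (min_le_right _ _)))
        (x s) p (hv1.trans (min_le_right _ _)) (by simpa using h.radius_pos.le)
      have hfp : ‖f p (μ s)‖ < c * η' / (2 * M ^ 2) := by
        have := hfδ (x := μ s) (by
          rw [Real.dist_eq]
          exact (hμs.trans ((min_le_left _ _).trans (min_le_left _ _))).trans_lt (by linarith))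
        rwa [hp, dist_zero_right] at this
      have h5 : ⟪P (x s - p), f p (μ s)⟫_ℝ ≤ M * η' * (c * η' / (2 * M ^ 2)) := by
        refine (inner_le P _ _).trans ?_
        gcongr
      have h6 : ⟪P (x s - p), f (x s) (μ s)⟫_ℝ =
          ⟪P (x s - p), f (x s) (μ s) - f p (μ s)⟫_ℝ + ⟪P (x s - p), f p (μ s)⟫_ℝ := by
        rw [← inner_add_right, sub_add_cancel]
      have h7 : M * η' * (c * η' / (2 * M ^ 2)) = c * (η' ^ 2 / M) / 2 := by field_simp
      have h8 : 0 < c * (η' ^ 2 / M) := by positivity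
      have h9 : c * (η' ^ 2 / M) ≤ c * ‖x s - p‖ ^ 2 := by gcongr
      rw [h6]
      nlinarith
  have h1 := (h.norm_sq_le (x t - p)).trans hV
  exact ((sq_le_sq₀ (norm_nonneg _) hη0.le).1 h1).trans (min_le_left _ _)

/-- Exponential decay of the Lyapunov function along solutions, up to a forcing term. -/
theorem energy_le (h : IsLocalContraction f l p P c ρ) {v v' : ℝ → Space n} {a b D e : ℝ}
    (hv : ContinuousOn v (Icc a b)) (hv' : ∀ t ∈ Ico a b, HasDerivWithinAt v (v' t) (Ici t) t)
    (hbound : ∀ t ∈ Ico a b, ⟪P (v t), v' t⟫_ℝ ≤ -c * ‖v t‖ ^ 2 + e)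
    (ha : ‖v a‖ ≤ D) (hab : a ≤ b) (he : 0 ≤ e) :
    ‖v b‖ ^ 2 ≤ (‖P‖ + 1) * D ^ 2 * Real.exp (-(2 * c / (‖P‖ + 1)) * (b - a)) +
      e * (‖P‖ + 1) / c := by
  set M := ‖P‖ + 1 with hM
  have hM0 : 0 < M := by positivity
  have hc := h.c_pos
  -- Since V ≤ M ‖v‖², the bound reads V' ≤ -(2c / M) V + 2e, a Grönwall inequality with negative
  -- rate.
  have h1 := le_gronwallBound_of_liminf_deriv_right_le (f := fun t => ⟪P (v t), v t⟫_ℝ)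
    (f' := fun t => 2 * ⟪P (v t), v' t⟫_ℝ) (δ := M * D ^ 2) (K := -(2 * c / M)) (ε := 2 * e)
    (a := a) (b := b) (by fun_prop)
    (fun t ht r hr => (h.hasDerivWithinAt (hv' t ht)).liminf_right_slope_le hr)
    ((inner_self_le P _).trans (by gcongr))
    (fun t ht => by
      have h2 := hbound t ht
      have h3 : 2 * c / M * ⟪P (v t), v t⟫_ℝ ≤ 2 * c * ‖v t‖ ^ 2 := by
        calc _ ≤ 2 * c / M * (M * ‖v t‖ ^ 2) := by gcongr; exact inner_self_le P _
          _ = _ := by field_simp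
      linarith) b ⟨hab, le_rfl⟩
  refine (h.norm_sq_le _).trans (h1.trans ?_)
  have hK : -(2 * c / M) ≠ 0 := by
    have : 0 < 2 * c / M := by positivity
    linarith
  rw [gronwallBound_of_K_ne_0 hK]
  have h4 : 2 * e / -(2 * c / M) * (Real.exp (-(2 * c / M) * (b - a)) - 1) =
      e * M / c - e * M / c * Real.exp (-(2 * c / M) * (b - a)) := by
    field_simp
    ring
  have h5 : 0 ≤ e * M / c * Real.exp (-(2 * c / M) * (b - a)) := by positivity
  dsimp only
  linarith

/-- After a long time with parameter close to `l₂`, a solution that stays near `p` is close to the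
equilibrium `p₂` for `l₂`. -/
theorem attract (h : IsLocalContraction f l p P c ρ) {p₂ : Space n} {l₂ : ℝ}
    (hp₂ : ‖p₂ - p‖ ≤ ρ) (hl₂ : |l₂ - l| < ρ) (hzero : f p₂ l₂ = 0)
    (hcont : ContinuousAt (fun m => f p₂ m) l₂) {η : ℝ} (hη : 0 < η) :
    ∃ T > 0, ∃ δ > 0, ∀ (μ : ℝ → ℝ) (x : ℝ → Space n) (a : ℝ), SolvesOn f μ a (a + T) x →
      (∀ t ∈ Ico a (a + T), |μ t - l₂| ≤ δ) → (∀ t ∈ Icc a (a + T), ‖x t - p‖ ≤ ρ) →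
      ‖x (a + T) - p₂‖ ≤ η := by
  set M := ‖P‖ + 1 with hM
  have hM0 : 0 < M := by positivity
  have hc := h.c_pos
  have hρ := h.radius_pos
  have hK : 0 < 2 * c / M := by positivity
  have hlim : Tendsto (fun T : ℝ => M * (2 * ρ) ^ 2 * Real.exp (-(2 * c / M) * T)) atTop (𝓝 0) := by
    have h1 : Tendsto (fun T : ℝ => -(2 * c / M) * T) atTop atBot :=
      tendsto_id.const_mul_atTop_of_neg (by linarith)
    simpa using (Real.tendsto_exp_atBot.comp h1).const_mul (M * (2 * ρ) ^ 2)
  -- The target η² is split evenly: T makes the decaying initial term less than η² / 2, and the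
  -- forcing level below contributes exactly η² / 2.
  have hη2 : 0 < η ^ 2 / 2 := by positivity
  obtain ⟨T, hT, hT0⟩ := ((hlim.eventually (gt_mem_nhds hη2)).and (eventually_gt_atTop 0)).exists
  have he : 0 < η ^ 2 / 2 * c / M / (M * (2 * ρ)) := by positivity
  obtain ⟨δ₁, hδ₁, hfδ⟩ := Metric.continuousAt_iff.1 hcont _ he
  refine ⟨T, hT0, min (δ₁ / 2) (ρ - |l₂ - l|), lt_min (by positivity) (by linarith), ?_⟩
  intro μ x a hx hμ hxρ
  have hdist : ∀ t ∈ Icc a (a + T), ‖x t - p₂‖ ≤ 2 * ρ := fun t ht => by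
    calc ‖x t - p₂‖ ≤ ‖x t - p‖ + ‖p - p₂‖ := norm_sub_le_norm_sub_add_norm_sub _ _ _
      _ ≤ 2 * ρ := by rw [norm_sub_rev p]; linarith [hxρ t ht]
  have h1 := h.energy_le (v := fun t => x t - p₂) (v' := fun t => f (x t) (μ t)) (a := a)
    (b := a + T) (D := 2 * ρ) (e := η ^ 2 / 2 * c / M)
    (by have := hx.continuousOn; fun_prop)
    (fun t ht => (hx.hasDeriv t ht).sub_const p₂)
    (fun t ht => by
      have hμt := hμ t ht
      have hμl : |μ t - l| ≤ ρ := by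
        calc |μ t - l| ≤ |μ t - l₂| + |l₂ - l| := abs_sub_le _ _ _
          _ ≤ ρ := by linarith [hμt.trans (min_le_right _ _)]
      have h2 := h.contract (μ t) hμl (x t) p₂ (hxρ t (Ico_subset_Icc_self ht)) hp₂
      have hfp : ‖f p₂ (μ t)‖ < η ^ 2 / 2 * c / M / (M * (2 * ρ)) := by
        have := hfδ (x := μ t) (by
          rw [Real.dist_eq]
          exact (hμt.trans (min_le_left _ _)).trans_lt (by linarith))
        rwa [hzero, dist_zero_right] at this
      have h5 : ⟪P (x t - p₂), f p₂ (μ t)⟫_ℝ ≤ η ^ 2 / 2 * c / M := by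
        calc _ ≤ M * ‖x t - p₂‖ * ‖f p₂ (μ t)‖ := inner_le P _ _
          _ ≤ M * (2 * ρ) * (η ^ 2 / 2 * c / M / (M * (2 * ρ))) := by
            gcongr
            exact hdist t (Ico_subset_Icc_self ht)
          _ = _ := by field_simp
      have h6 : ⟪P (x t - p₂), f (x t) (μ t)⟫_ℝ =
          ⟪P (x t - p₂), f (x t) (μ t) - f p₂ (μ t)⟫_ℝ + ⟪P (x t - p₂), f p₂ (μ t)⟫_ℝ := by
        rw [← inner_add_right, sub_add_cancel]
      rw [h6]
      linarith)
    (hdist a ⟨le_rfl, by linarith⟩) (by linarith) (by positivity)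
  rw [add_sub_cancel_left] at h1
  have h7 : η ^ 2 / 2 * c / M * (‖P‖ + 1) / c = η ^ 2 / 2 := by
    rw [← hM]; field_simp
  rw [h7] at h1
  exact (sq_le_sq₀ (norm_nonneg _) hη.le).1 (by linarith)

/-- Two solutions that stay near `p` for all negative times coincide. -/
theorem eq_of_forall_le (h : IsLocalContraction f l p P c ρ) {μ : ℝ → ℝ} {x y : ℝ → Space n}
    {t : ℝ} (hx : ∀ a ≤ t, SolvesOn f μ a t x) (hy : ∀ a ≤ t, SolvesOn f μ a t y)
    (hμ : ∀ s ≤ t, |μ s - l| ≤ ρ) (hxp : ∀ s ≤ t, ‖x s - p‖ ≤ ρ) (hyp : ∀ s ≤ t, ‖y s - p‖ ≤ ρ) :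
    x t = y t := by
  set M := ‖P‖ + 1 with hM
  have hM0 : 0 < M := by positivity
  have hc := h.c_pos
  have hK : 0 < 2 * c / M := by positivity
  -- The gap at time a is at most 2ρ and contracts exponentially without forcing; letting a → -∞
  -- leaves nothing at t.
  have hle : ∀ a ≤ t, ‖x t - y t‖ ^ 2 ≤
      M * (2 * ρ) ^ 2 * Real.exp (-(2 * c / M) * (t - a)) := by
    intro a ha
    have h1 := h.energy_le (v := fun t => x t - y t)
      (v' := fun t => f (x t) (μ t) - f (y t) (μ t)) (a := a)
      (b := t) (D := 2 * ρ) (e := 0)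
      ((hx a ha).continuousOn.sub (hy a ha).continuousOn)
      (fun s hs => ((hx a ha).hasDeriv s hs).sub ((hy a ha).hasDeriv s hs))
      (fun s hs => by
        rw [add_zero]
        exact h.contract _ (hμ s hs.2.le) _ _ (hxp s hs.2.le) (hyp s hs.2.le))
      (by
        calc ‖x a - y a‖ ≤ ‖x a - p‖ + ‖p - y a‖ := norm_sub_le_norm_sub_add_norm_sub _ _ _
          _ ≤ 2 * ρ := by rw [norm_sub_rev p]; linarith [hxp a ha, hyp a ha])
      ha le_rfl
    simpa using h1
  have hlim : Tendsto (fun a : ℝ => M * (2 * ρ) ^ 2 * Real.exp (-(2 * c / M) * (t - a))) atBot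
      (𝓝 0) := by
    have h0 : Tendsto (fun a : ℝ => t - a) atBot atTop := tendsto_atTop_add_const_left _ t
      tendsto_neg_atBot_atTop
    have h1 : Tendsto (fun a : ℝ => -(2 * c / M) * (t - a)) atBot atBot :=
      h0.const_mul_atTop_of_neg (by linarith)
    simpa using (Real.tendsto_exp_atBot.comp h1).const_mul (M * (2 * ρ) ^ 2)
  have h2 := ge_of_tendsto hlim ((eventually_le_atBot t).mono hle)
  exact sub_eq_zero.1 (norm_eq_zero.1 (pow_eq_zero_iff two_ne_zero |>.1
    (le_antisymm h2 (sq_nonneg _))))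

end IsLocalContraction

end LocalContraction

/-! ### Cutoffs, continuous dependence and uniqueness -/

open scoped Manifold ContDiff

/-- A `C²` function on an open set agrees near any compact subset with a globally defined, bounded,
Lipschitz function. -/
theorem exists_lipschitz_cutoff {E F : Type*} [NormedAddCommGroup E] [NormedSpace ℝ E]
    [FiniteDimensional ℝ E] [NormedAddCommGroup F] [NormedSpace ℝ F] {W K : Set E} {φ : E → F}
    (hW : IsOpen W) (hφ : ContDiffOn ℝ 2 φ W) (hK : IsCompact K) (hKW : K ⊆ W) :
    ∃ (G : E → F) (L : NNReal) (M : ℝ) (ρ : ℝ), LipschitzWith L G ∧ (∀ q, ‖G q‖ ≤ M) ∧ 0 < ρ ∧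
      ∀ q ∈ K, ∀ q', dist q' q ≤ ρ → q' ∈ W ∧ G q' = φ q' := by
  have : ProperSpace E := FiniteDimensional.proper ℝ E
  obtain ⟨T, hT, hKT, hTW⟩ := exists_compact_between hK hW hKW
  obtain ⟨χ, hχ1, hχ0, -⟩ := exists_contMDiffMap_one_nhds_of_subset_interior 𝓘(ℝ, E) (n := 2)
    hK.isClosed hKT
  have hχ : ContDiff ℝ 2 χ := contMDiff_iff_contDiff.1 χ.contMDiff
  -- χ is 1 near K and 0 off the compact T ⊆ W, so G is C² on the whole space even though φ is
  -- controlled only on W.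
  set G : E → F := fun q => χ q • φ q with hG
  have hzero : ∀ q ∉ T, G q = 0 := fun q hq => by simp [hG, hχ0 q hq]
  have hsupp : HasCompactSupport G := HasCompactSupport.intro hT hzero
  have hGd : ContDiff ℝ 2 G := by
    rw [contDiff_iff_contDiffAt]
    intro q
    by_cases hq : q ∈ T
    · exact hχ.contDiffAt.smul (hφ.contDiffAt (hW.mem_nhds (hTW hq)))
    · refine (contDiffAt_const (c := (0 : F))).congr_of_eventuallyEq ?_
      filter_upwards [hT.isClosed.isOpen_compl.mem_nhds hq] with q' hq' using hzero q' hq'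
  obtain ⟨L, hL⟩ := ContDiff.lipschitzWith_of_hasCompactSupport hsupp hGd (by norm_num)
  obtain ⟨M, hM⟩ := hsupp.exists_bound_of_continuous hGd.continuous
  have hev : ∀ᶠ q in 𝓝ˢ K, q ∈ W ∧ G q = φ q := by
    filter_upwards [hχ1, hW.mem_nhdsSet.2 hKW] with q h1 h2
    exact ⟨h2, by simp [hG, h1]⟩
  obtain ⟨ρ, hρ, hsub⟩ := hK.exists_cthickening_subset_open
    (isOpen_interior (s := {q | q ∈ W ∧ G q = φ q})) (subset_interior_iff_mem_nhdsSet.2 hev)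
  refine ⟨G, L, M, ρ, hL, hM, hρ, fun q hq q' hd => ?_⟩
  have hmem : q' ∈ {q | q ∈ W ∧ G q = φ q} :=
    interior_subset (hsub (Metric.mem_cthickening_of_dist_le q' q ρ K hq hd))
  exact hmem

section Compare

variable {n : ℕ} {U : Set (Space n)} {f : Space n → ℝ → Space n}

/-- Continuous dependence on initial data and on the parameter. -/
theorem exists_forall_norm_sub_le (hU : IsOpen U)
    (hf : ContDiffOn ℝ 2 (fun q : Space n × ℝ => f q.1 q.2) (U ×ˢ univ))
    {z : ℝ → Space n} {ν : ℝ → ℝ} {a b R : ℝ} (hz : SolvesOn f ν a b z)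
    (hzU : ∀ t ∈ Icc a b, z t ∈ U) (hν : ∀ t ∈ Ico a b, |ν t| ≤ R) {η : ℝ} (hη : 0 < η) :
    ∃ δ₀ > 0, ∃ C ≥ 1, ∀ δ, 0 < δ → δ ≤ δ₀ → ∀ (μ : ℝ → ℝ) (x : ℝ → Space n), SolvesOn f μ a b x →
      (∀ t ∈ Ico a b, |μ t - ν t| ≤ δ) → ‖x a - z a‖ ≤ δ →
      ∀ t ∈ Icc a b, ‖x t - z t‖ ≤ min η (C * δ) := by
  have hK : IsCompact ((z '' Icc a b) ×ˢ Icc (-R) R) :=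
    (isCompact_Icc.image_of_continuousOn hz.continuousOn).prod isCompact_Icc
  have hKW : (z '' Icc a b) ×ˢ Icc (-R) R ⊆ U ×ˢ univ := by
    rintro ⟨y, m⟩ ⟨⟨t, ht, rfl⟩, -⟩
    exact ⟨hzU t ht, mem_univ _⟩
  obtain ⟨G, L, -, ρ, hL, -, hρ, hG⟩ :=
    exists_lipschitz_cutoff (hU.prod isOpen_univ) hf hK hKW
  set k : ℝ := L + 1 with hk
  have hL0 : (0 : ℝ) ≤ L := L.2
  have hk0 : 0 < k := by positivity
  set C : ℝ := max 1 (Real.exp (k * (b - a))) with hC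
  have hC0 : 0 < C := lt_max_of_lt_left one_pos
  refine ⟨min ρ η / C, by positivity, C, le_max_left _ _, ?_⟩
  intro δ hδ0 hδ μ x hx hμ hxa t ht
  have hδC : C * δ ≤ min ρ η := by rw [mul_comm]; exact (le_div_iff₀ hC0).1 hδ
  have hB : ∀ s ∈ Icc a b, δ * Real.exp (k * (s - a)) ≤ C * δ := by
    intro s hs
    rw [mul_comm C]
    gcongr
    refine le_trans ?_ (le_max_right _ _)
    gcongr
    exact hs.2
  -- The derivative is needed only where the distance touches the barrier. There (x, μ) is within ρ
  -- of the compact set, so f may be replaced by G, and nothing need be known in advance about where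
  -- x goes. The `+ 1` in k makes the comparison strict.
  have h1 : ‖x t - z t‖ ≤ δ * Real.exp (k * (t - a)) := by
    refine image_norm_le_of_norm_deriv_right_lt_deriv_boundary (f := fun t => x t - z t)
      (f' := fun t => f (x t) (μ t) - f (z t) (ν t))
      (B := fun s => δ * Real.exp (k * (s - a))) (B' := fun s => δ * (Real.exp (k * (s - a)) * k))
      (hx.continuousOn.sub hz.continuousOn)
      (fun s hs => (hx.hasDeriv s hs).sub (hz.hasDeriv s hs)) (by simpa using hxa) ?_ ?_ ht
    · intro s
      have := (((hasDerivAt_id s).sub_const a).const_mul k).exp.const_mul δ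
      simpa using this
    · intro s hs hs'
      have hsI := Ico_subset_Icc_self hs
      have hexp : 1 ≤ Real.exp (k * (s - a)) :=
        Real.one_le_exp (mul_nonneg hk0.le (by linarith [hs.1]))
      have hδs : δ ≤ δ * Real.exp (k * (s - a)) := le_mul_of_one_le_right hδ0.le hexp
      have hq : (z s, ν s) ∈ (z '' Icc a b) ×ˢ Icc (-R) R :=
        ⟨⟨s, hsI, rfl⟩, abs_le.1 (hν s hs)⟩
      have hd : dist (x s, μ s) (z s, ν s) ≤ δ * Real.exp (k * (s - a)) := by
        rw [Prod.dist_eq, dist_eq_norm, Real.dist_eq]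
        exact max_le hs'.le ((hμ s hs).trans hδs)
      have e1 := (hG _ hq (x s, μ s) (hd.trans ((hB s hsI).trans (hδC.trans (min_le_left _ _))))).2
      have e2 := (hG _ hq (z s, ν s) (by simpa using hρ.le)).2
      dsimp only at e1 e2
      rw [← e1, ← e2, ← dist_eq_norm]
      have h3 := hL.dist_le_mul (x s, μ s) (z s, ν s)
      have h4 : 0 < δ * Real.exp (k * (s - a)) := by positivity
      calc _ ≤ (L : ℝ) * dist (x s, μ s) (z s, ν s) := h3
        _ ≤ L * (δ * Real.exp (k * (s - a))) := by gcongr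
        _ < δ * (Real.exp (k * (s - a)) * k) := by rw [hk]; nlinarith
  have h2 := h1.trans (hB t ht)
  exact le_min (h2.trans (hδC.trans (min_le_right _ _))) h2

/-- Uniqueness of solutions of the initial value problem. -/
theorem SolvesOn.eqOn (hU : IsOpen U)
    (hf : ContDiffOn ℝ 2 (fun q : Space n × ℝ => f q.1 q.2) (U ×ˢ univ))
    {z x : ℝ → Space n} {ν : ℝ → ℝ} {a b R : ℝ} (hz : SolvesOn f ν a b z)
    (hzU : ∀ t ∈ Icc a b, z t ∈ U) (hν : ∀ t ∈ Ico a b, |ν t| ≤ R) (hx : SolvesOn f ν a b x)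
    (ha : x a = z a) : EqOn x z (Icc a b) := by
  intro t ht
  obtain ⟨δ₀, hδ₀, C, hC, h⟩ := exists_forall_norm_sub_le hU hf hz hzU hν one_pos
  have h1 : ∀ᶠ δ in 𝓝[>] (0 : ℝ), ‖x t - z t‖ ≤ C * δ := by
    filter_upwards [Ioo_mem_nhdsGT hδ₀] with δ hδ
    refine (h δ hδ.1 hδ.2.le ν x hx (fun s _ => ?_) ?_ t ht).trans (min_le_right _ _)
    · simpa using hδ.1.le
    · simpa [ha] using hδ.1.le
  have h2 : Tendsto (fun δ : ℝ => C * δ) (𝓝[>] 0) (𝓝 0) := by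
    have : Tendsto (fun δ : ℝ => C * δ) (𝓝 0) (𝓝 (C * 0)) := (continuous_const_mul C).tendsto 0
    rw [mul_zero] at this
    exact this.mono_left nhdsWithin_le_nhds
  have h3 := ge_of_tendsto h2 h1
  exact sub_eq_zero.1 (norm_le_zero_iff.1 h3)

/-- Over a short time, solutions do not move far, whatever the parameter does in a bounded set. -/
theorem exists_forall_norm_sub_le_of_short (hU : IsOpen U)
    (hf : ContDiffOn ℝ 2 (fun q : Space n × ℝ => f q.1 q.2) (U ×ˢ univ))
    {p : Space n} (hp : p ∈ U) (R : ℝ) {η : ℝ} (hη : 0 < η) :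
    ∃ δ > 0, ∀ (μ : ℝ → ℝ) (x : ℝ → Space n) (a b : ℝ), SolvesOn f μ a b x →
      (∀ t ∈ Ico a b, |μ t| ≤ R) → ‖x a - p‖ ≤ δ → b - a ≤ δ → ∀ t ∈ Icc a b, ‖x t - p‖ ≤ η := by
  have hK : IsCompact (({p} : Set (Space n)) ×ˢ Icc (-R) R) := isCompact_singleton.prod isCompact_Icc
  have hKW : ({p} : Set (Space n)) ×ˢ Icc (-R) R ⊆ U ×ˢ univ := by
    rintro ⟨y, m⟩ ⟨rfl, -⟩
    exact ⟨hp, mem_univ _⟩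
  obtain ⟨G, -, M, ρ, -, hM, hρ, hG⟩ :=
    exists_lipschitz_cutoff (hU.prod isOpen_univ) hf hK hKW
  have hM0 : 0 ≤ M := (norm_nonneg _).trans (hM (p, 0))
  set η' := min η ρ with hη'
  have hη0 : 0 < η' := lt_min hη hρ
  -- An initial error δ plus speed M + 1, just above the bound on G, over a time δ adds up to (M +
  -- 2) δ = η'.
  refine ⟨η' / (M + 2), by positivity, ?_⟩
  intro μ x a b hx hμ hxa hab t ht
  have hB : ∀ s ∈ Icc a b, η' / (M + 2) + (M + 1) * (s - a) ≤ η' := by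
    intro s hs
    have h1 : s - a ≤ η' / (M + 2) := by linarith [hs.2]
    calc _ ≤ η' / (M + 2) + (M + 1) * (η' / (M + 2)) := by gcongr
      _ = η' := by field_simp; ring
  have h1 : ‖x t - p‖ ≤ η' / (M + 2) + (M + 1) * (t - a) := by
    refine image_norm_le_of_norm_deriv_right_lt_deriv_boundary (f := fun t => x t - p)
      (f' := fun t => f (x t) (μ t))
      (B := fun s => η' / (M + 2) + (M + 1) * (s - a)) (B' := fun s => M + 1)
      (hx.continuousOn.sub continuousOn_const)
      (fun s hs => (hx.hasDeriv s hs).sub_const p) (by simpa using hxa) ?_ ?_ ht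
    · intro s
      have := (((hasDerivAt_id s).sub_const a).const_mul (M + 1)).const_add (η' / (M + 2))
      simpa using this
    · intro s hs hs'
      have hd : dist (x s, μ s) (p, μ s) ≤ ρ := by
        rw [Prod.dist_eq, dist_eq_norm, dist_self]
        refine max_le ?_ hρ.le
        dsimp only at hs' ⊢
        rw [hs']
        exact (hB s (Ico_subset_Icc_self hs)).trans (min_le_right _ _)
      have e1 := (hG (p, μ s) ⟨rfl, abs_le.1 (hμ s hs)⟩ (x s, μ s) hd).2
      dsimp only at e1
      rw [← e1]
      linarith [hM (x s, μ s)]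
  exact (h1.trans (hB t ht)).trans (min_le_left _ _)

theorem SolvesOn.of_forward {l : ℝ} {w : ℝ → Space n}
    (hw : ∀ t : ℝ, 0 ≤ t → w t ∈ U ∧ HasDerivWithinAt w (f (w t) l) (Ici 0) t) (T : ℝ) :
    SolvesOn f (fun _ => l) 0 T w :=
  ⟨fun t ht => (hw t ht.1).2.continuousWithinAt.mono fun _ hs => hs.1,
    fun t ht => (hw t ht.1).2.mono (Ici_subset_Ici.2 ht.1)⟩

/-- Two basins for the same parameter that share a point belong to the same equilibrium. -/
theorem eq_of_mem_basin (hU : IsOpen U)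
    (hf : ContDiffOn ℝ 2 (fun q : Space n × ℝ => f q.1 q.2) (U ×ˢ univ))
    {l : ℝ} {p q a : Space n} (hp : a ∈ basin U f l p) (hq : a ∈ basin U f l q) : p = q := by
  obtain ⟨x, hx0, hx, hxp⟩ := hp
  obtain ⟨y, hy0, hy, hyq⟩ := hq
  have heq : ∀ t, 0 ≤ t → x t = y t := fun t ht =>
    (SolvesOn.of_forward hy t).eqOn hU hf (fun s hs => (hy s hs.1).1) (R := |l|)
      (fun _ _ => le_rfl) (SolvesOn.of_forward hx t)
      (hx0.trans hy0.symm) ⟨ht, le_rfl⟩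
  refine tendsto_nhds_unique hxp (hyq.congr' ?_)
  filter_upwards [eventually_ge_atTop 0] with t ht using (heq t ht).symm

end Compare

/-! ### Existence and uniqueness of the local pullback attractor -/

/-- Global existence for bounded, uniformly Lipschitz time-dependent vector fields. -/
theorem exists_solution_of_lipschitz {E : Type*} [NormedAddCommGroup E] [NormedSpace ℝ E]
    [CompleteSpace E] {v : ℝ → E → E} {L : NNReal} {M : ℝ} (hL : ∀ t, LipschitzWith L (v t))
    (hv : ∀ x, Continuous fun t => v t x) (hM : ∀ t x, ‖v t x‖ ≤ M) {a b : ℝ} (hab : a ≤ b)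
    (x₀ : E) :
    ∃ α : ℝ → E, α a = x₀ ∧ ∀ t ∈ Icc a b, HasDerivWithinAt α (v t (α t)) (Icc a b) t := by
  have hM0 : 0 ≤ M := (norm_nonneg _).trans (hM a x₀)
  -- The radius M (b - a) is what speed M can cover, so a single application spans all of [a, b].
  have hpl : IsPicardLindelof v (⟨a, le_rfl, hab⟩ : Icc a b) x₀
      (⟨M * (b - a), mul_nonneg hM0 (sub_nonneg.2 hab)⟩ : NNReal) 0 ⟨M, hM0⟩ L :=
    { lipschitzOnWith := fun t _ => (hL t).lipschitzOnWith
      continuousOn := fun x _ => (hv x).continuousOn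
      norm_le := fun t _ x _ => hM t x
      mul_max_le := by
        change M * max (b - a) (a - a) ≤ M * (b - a) - 0
        simp [hab] }
  exact hpl.exists_eq_forall_mem_Icc_hasDerivWithinAt₀

section Pullback

variable {n : ℕ} {U : Set (Space n)} {f : Space n → ℝ → Space n} {l : ℝ} {p : Space n}

/-- Existence of a solution that tends to an attracting equilibrium of the past limit system as
`t → -∞`. -/
theorem exists_solution_tendsto_atBot (hU : IsOpen U)
    (hf : ContDiffOn ℝ 2 (fun q : Space n × ℝ => f q.1 q.2) (U ×ˢ univ))
    (hp : IsAttractingEquilibrium U f l p) {μ : ℝ → ℝ} (hμ : Continuous μ)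
    (hμl : Tendsto μ atBot (𝓝 l)) :
    ∃ (t₀ : ℝ) (x : ℝ → Space n), (∀ t < t₀, x t ∈ U ∧ HasDerivAt x (f (x t) (μ t)) t) ∧
      Tendsto x atBot (𝓝 p) := by
  obtain ⟨P, c, ρ₀, hLC⟩ := hp.exists_isLocalContraction hU hf
  obtain ⟨G, L, M, ρ₁, hL, hM, hρ₁, hG⟩ := exists_lipschitz_cutoff (hU.prod isOpen_univ) hf
    (isCompact_singleton (x := (p, l))) (by rintro q rfl; exact ⟨hp.mem, mem_univ _⟩)
  have hρ := lt_min hLC.radius_pos hρ₁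
  set ρ := min ρ₀ ρ₁ with hρdef
  set g : Space n → ℝ → Space n := fun x m => G (x, m) with hg
  have hgf : ∀ x m, ‖x - p‖ ≤ ρ → |m - l| ≤ ρ → x ∈ U ∧ g x m = f x m := by
    intro x m hx hm
    have := hG (p, l) rfl (x, m) (by
      rw [Prod.dist_eq, dist_eq_norm, Real.dist_eq]
      exact max_le (hx.trans (min_le_right _ _)) (hm.trans (min_le_right _ _)))
    exact ⟨this.1.1, this.2⟩
  have hLCg : IsLocalContraction g l p P c ρ :=
    (hLC.mono hρ (min_le_left _ _)).congr fun x m hx hm => (hgf x m hx hm).2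
  have hgp : g p l = 0 := by
    rw [(hgf p l (by simpa using hρ.le) (by simpa using hρ.le)).2, hp.eq_zero]
  have hgcont : ContinuousAt (fun m => g p m) l :=
    (hL.continuous.comp (by fun_prop : Continuous fun m : ℝ => (p, m))).continuousAt
  have hpast : ∀ δ > 0, ∃ t₁, ∀ s ≤ t₁, |μ s - l| ≤ δ := by
    intro δ hδ
    have h1 := (Metric.tendsto_nhds.1 hμl δ hδ)
    obtain ⟨t₁, ht₁⟩ := eventually_atBot.1 h1
    exact ⟨t₁, fun s hs => (Real.dist_eq _ _ ▸ ht₁ s hs).le⟩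
  obtain ⟨δ₁, hδ₁, htrap⟩ := hLCg.trap hgp hgcont hρ
  obtain ⟨t₁, ht₁⟩ := hpast (min δ₁ ρ) (lt_min hδ₁ hρ)
  have hex : ∀ (m : ℕ) (x₀ : Space n), ∃ α : ℝ → Space n, α (t₁ - m) = x₀ ∧
      ∀ t ∈ Icc (t₁ - m) t₁, HasDerivWithinAt α (g (α t) (μ t)) (Icc (t₁ - m) t₁) t := by
    intro m x₀
    refine exists_solution_of_lipschitz (v := fun t x => g x (μ t)) (L := L) (M := M) ?_ ?_ ?_
      (by simp) x₀
    · intro t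
      have := hL.comp (LipschitzWith.prodMk_right (α := Space n) (μ t))
      rwa [mul_one] at this
    · intro x
      exact hL.continuous.comp (by fun_prop)
    · intro t x
      exact hM _
  have hsol : ∀ (m : ℕ) (α : ℝ → Space n),
      (∀ t ∈ Icc (t₁ - m) t₁, HasDerivWithinAt α (g (α t) (μ t)) (Icc (t₁ - m) t₁) t) →
      SolvesOn g μ (t₁ - m) t₁ α := fun m α h =>
    ⟨fun t ht => (h t ht).continuousWithinAt, fun t ht =>
      (h t (Ico_subset_Icc_self ht)).mono_of_mem_nhdsWithin (Icc_mem_nhdsGE_of_mem ht)⟩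
  -- The pullback construction: start at p at time t₁ - k and let k → ∞. Trapping keeps all these
  -- solutions in the ρ-ball, where the cutoff field agrees with f.
  choose X hX0 hXd using fun k : ℕ => hex k p
  have hXs : ∀ k : ℕ, SolvesOn g μ (t₁ - k) t₁ (X k) := fun k => hsol k _ (hXd k)
  have hXρ : ∀ k : ℕ, ∀ t ∈ Icc (t₁ - k) t₁, ‖X k t - p‖ ≤ ρ := fun k =>
    htrap μ (X k) _ _ (hXs k) (fun t ht => (ht₁ t ht.2.le).trans (min_le_left _ _))
      (by rw [hX0, sub_self, norm_zero]; exact hδ₁.le)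
  have hlarge : ∀ t : ℝ, ∀ᶠ k : ℕ in atTop, t₁ - k ≤ t := fun t => by
    obtain ⟨N, hN⟩ := exists_nat_ge (t₁ - t)
    filter_upwards [eventually_ge_atTop N] with k hk
    have : (N : ℝ) ≤ k := by exact_mod_cast hk
    linarith
  -- Limits along one ultrafilter exist at all times at once by compactness of the ball, replacing a
  -- diagonal extraction.
  let 𝒰 : Ultrafilter ℕ := Ultrafilter.of atTop
  have h𝒰 : (𝒰 : Filter ℕ) ≤ atTop := Ultrafilter.of_le _
  have hlim : ∀ t : ℝ, ∃ y : Space n, t ≤ t₁ → Tendsto (fun k => X k t) 𝒰 (𝓝 y) := by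
    intro t
    by_cases ht : t ≤ t₁
    · have hmem : Metric.closedBall p ρ ∈ 𝒰.map fun k => X k t := by
        refine h𝒰 ?_
        filter_upwards [hlarge t] with k hk
        simpa [dist_eq_norm] using hXρ k t ⟨hk, ht⟩
      obtain ⟨y, -, hy⟩ := (isCompact_closedBall p ρ).ultrafilter_le_nhds' _ hmem
      exact ⟨y, fun _ => hy⟩
    · exact ⟨p, fun h => (ht h).elim⟩
  choose y hy using hlim
  have hyle : ∀ η : ℝ, ∀ t ≤ t₁, (∀ᶠ k : ℕ in atTop, ‖X k t - p‖ ≤ η) → ‖y t - p‖ ≤ η := by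
    intro η t ht hev
    exact le_of_tendsto ((hy t ht).sub_const p).norm (h𝒰 hev)
  have hyρ : ∀ t ≤ t₁, ‖y t - p‖ ≤ ρ := fun t ht =>
    hyle ρ t ht ((hlarge t).mono fun k hk => hXρ k t ⟨hk, ht⟩)
  -- The limit is a solution: compare X k with the exact solution w through y (t₁ - m). Their
  -- distance is at most a fixed multiple of the gap at t₁ - m, which tends to 0 along 𝒰.
  have hyeq : ∀ m : ℕ, ∃ w : ℝ → Space n,
      (∀ t ∈ Icc (t₁ - m) t₁, HasDerivWithinAt w (g (w t) (μ t)) (Icc (t₁ - m) t₁) t) ∧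
      ∀ t ∈ Icc (t₁ - m) t₁, y t = w t := by
    intro m
    obtain ⟨w, hw0, hwd⟩ := hex m (y (t₁ - m))
    refine ⟨w, hwd, fun t ht => ?_⟩
    refine tendsto_nhds_unique (hy t ht.2) ?_
    rw [tendsto_iff_dist_tendsto_zero]
    have h1 := (tendsto_iff_dist_tendsto_zero.1 (hy (t₁ - m) (by simp))).mul_const
      (Real.exp (L * (t - (t₁ - m))))
    rw [zero_mul] at h1
    refine squeeze_zero' (Eventually.of_forall fun _ => dist_nonneg) ?_ h1
    refine h𝒰 ?_
    filter_upwards [eventually_ge_atTop m] with k hk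
    have hk' : (m : ℝ) ≤ k := by exact_mod_cast hk
    have hs := (hXs k).mono (a' := t₁ - m) (by linarith) le_rfl
    have hw := hsol m w hwd
    refine dist_le_of_trajectories_ODE (v := fun t x => g x (μ t)) (K := L) (fun t => ?_)
      hs.continuousOn hs.hasDeriv hw.continuousOn hw.hasDeriv (by rw [hw0]) t ht
    have := hL.comp (LipschitzWith.prodMk_right (α := Space n) (μ t))
    rwa [mul_one] at this
  refine ⟨t₁, y, fun t ht => ?_, ?_⟩
  · obtain ⟨h1, h2⟩ := hgf (y t) (μ t) (hyρ t ht.le) ((ht₁ t ht.le).trans (min_le_right _ _))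
    refine ⟨h1, ?_⟩
    obtain ⟨m, hm⟩ := exists_nat_gt (t₁ - t)
    obtain ⟨w, hwd, hyw⟩ := hyeq m
    have hnhds : Icc (t₁ - m) t₁ ∈ 𝓝 t := Icc_mem_nhds (by linarith) ht
    have hmem : t ∈ Icc (t₁ - m) t₁ := mem_of_mem_nhds hnhds
    rw [← h2, hyw t hmem]
    refine ((hwd t hmem).hasDerivAt hnhds).congr_of_eventuallyEq ?_
    filter_upwards [hnhds] with s hs using hyw s hs
  · rw [Metric.tendsto_nhds]
    intro ε hε
    obtain ⟨δ, hδ, htr⟩ := hLCg.trap hgp hgcont (half_pos hε)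
    obtain ⟨t₂, ht₂⟩ := hpast δ hδ
    filter_upwards [eventually_le_atBot (min t₁ t₂)] with t ht
    rw [dist_eq_norm]
    refine lt_of_le_of_lt (hyle (ε / 2) t (ht.trans (min_le_left _ _)) ?_) (by linarith)
    filter_upwards [hlarge t] with k hk
    exact htr μ (X k) (t₁ - k) t ((hXs k).mono le_rfl (ht.trans (min_le_left _ _)))
      (fun s hs => ht₂ s (hs.2.le.trans (ht.trans (min_le_right _ _))))
      (by rw [hX0, sub_self, norm_zero]; exact hδ.le) t ⟨hk, le_rfl⟩

variable {Λ : ℝ → ℝ} {r : ℝ}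

theorem IsTrajectory.solvesOn {c : EReal} {x : ℝ → Space n} (h : IsTrajectory U f Λ r c x)
    {a b : ℝ} (hb : (b : EReal) < c) : SolvesOn f (fun t => Λ (r * t)) a b x :=
  SolvesOn.of_hasDerivAt fun t ht =>
    (h t (lt_of_le_of_lt (EReal.coe_le_coe_iff.2 ht.2) hb)).2

/-- Uniqueness of trajectories with prescribed limit at `-∞`. -/
theorem IsTrajectory.eq_of_tendsto_atBot (hU : IsOpen U)
    (hf : ContDiffOn ℝ 2 (fun q : Space n × ℝ => f q.1 q.2) (U ×ˢ univ))
    (hp : IsAttractingEquilibrium U f l p) (hΛ : Continuous Λ)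
    (hΛl : Tendsto (fun t => Λ (r * t)) atBot (𝓝 l)) {c₁ c₂ : EReal} {x y : ℝ → Space n}
    (hx : IsTrajectory U f Λ r c₁ x) (hy : IsTrajectory U f Λ r c₂ y)
    (hxp : Tendsto x atBot (𝓝 p)) (hyp : Tendsto y atBot (𝓝 p)) {t : ℝ}
    (h₁ : (t : EReal) < c₁) (h₂ : (t : EReal) < c₂) : x t = y t := by
  obtain ⟨P, c, ρ, hLC⟩ := hp.exists_isLocalContraction hU hf
  have hρ := hLC.radius_pos
  have hev := ((Metric.tendsto_nhds.1 hxp ρ hρ).and (Metric.tendsto_nhds.1 hyp ρ hρ)).and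
    (Metric.tendsto_nhds.1 hΛl ρ hρ)
  obtain ⟨t₁, ht₁⟩ := eventually_atBot.1 hev
  simp only [dist_eq_norm, Real.norm_eq_abs] at ht₁
  have hle : ∀ {s : ℝ} {d : EReal}, s ≤ t → (t : EReal) < d → (s : EReal) < d := fun hs hd =>
    lt_of_le_of_lt (EReal.coe_le_coe_iff.2 hs) hd
  -- Contraction in the distant past identifies the two trajectories up to t₁; ordinary forward
  -- uniqueness then carries the equality to t.
  have heq : x (min t t₁) = y (min t t₁) := by
    have hs : ∀ s ≤ min t t₁, s ≤ t₁ := fun s hs => hs.trans (min_le_right _ _)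
    refine hLC.eq_of_forall_le (μ := fun t => Λ (r * t))
      (fun a _ => hx.solvesOn (hle (min_le_left _ _) h₁))
      (fun a _ => hy.solvesOn (hle (min_le_left _ _) h₂))
      (fun s h => (ht₁ s (hs s h)).2.le) (fun s h => (ht₁ s (hs s h)).1.1.le)
      (fun s h => (ht₁ s (hs s h)).1.2.le)
  have hcont : Continuous fun t => Λ (r * t) := by fun_prop
  obtain ⟨R, hR⟩ := isCompact_Icc.exists_bound_of_continuousOn (s := Icc (min t t₁) t)
    hcont.continuousOn
  exact (hy.solvesOn h₂).eqOn hU hf (R := R) (fun s hs => (hy s (hle hs.2 h₂)).1)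
    (fun s hs => hR s (Ico_subset_Icc_self hs)) (hx.solvesOn h₁) heq ⟨min_le_left _ _, le_rfl⟩

/-- The local pullback attractor to an attracting equilibrium of the past limit system exists. -/
theorem exists_isPullbackAttractor (hU : IsOpen U)
    (hf : ContDiffOn ℝ 2 (fun q : Space n × ℝ => f q.1 q.2) (U ×ˢ univ))
    (hp : IsAttractingEquilibrium U f l p) (hΛ : Continuous Λ)
    (hΛl : Tendsto (fun t => Λ (r * t)) atBot (𝓝 l)) :
    ∃ (b : EReal) (x : ℝ → Space n), IsPullbackAttractor U f Λ r p b x := by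
  classical
  let Q : EReal → (ℝ → Space n) → Prop := fun c y =>
    IsTrajectory U f Λ r c y ∧ Tendsto y atBot (𝓝 p)
  have huniq : ∀ {c₁ c₂ : EReal} {x y : ℝ → Space n}, Q c₁ x → Q c₂ y → ∀ {t : ℝ},
      (t : EReal) < c₁ → (t : EReal) < c₂ → x t = y t := fun h₁ h₂ _ ht₁ ht₂ =>
    h₁.1.eq_of_tendsto_atBot hU hf hp hΛ hΛl h₂.1 h₁.2 h₂.2 ht₁ ht₂
  -- Trajectories agree wherever both are defined, so they glue up to the supremum of their end
  -- times; p is a dummy value where none is defined.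
  let x : ℝ → Space n := fun t =>
    if h : ∃ q : EReal × (ℝ → Space n), Q q.1 q.2 ∧ (t : EReal) < q.1 then h.choose.2 t else p
  have hx : ∀ {c : EReal} {y : ℝ → Space n}, Q c y → ∀ {t : ℝ}, (t : EReal) < c →
      x t = y t := by
    intro c y hy t ht
    have hex : ∃ q : EReal × (ℝ → Space n), Q q.1 q.2 ∧ (t : EReal) < q.1 := ⟨(c, y), hy, ht⟩
    simp only [x, dif_pos hex]
    exact huniq hex.choose_spec.1 hy hex.choose_spec.2 ht
  have hnear : ∀ {c : EReal} {t : ℝ}, (t : EReal) < c → ∀ᶠ s : ℝ in 𝓝 t, (s : EReal) < c :=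
    fun ht => continuous_coe_real_ereal.continuousAt.eventually (gt_mem_nhds ht)
  obtain ⟨t₀, y₀, hy₀, hy₀p⟩ := exists_solution_tendsto_atBot hU hf hp
    (μ := fun t => Λ (r * t)) (by fun_prop) hΛl
  have hQ₀ : Q t₀ y₀ := ⟨fun t ht => hy₀ t (EReal.coe_lt_coe_iff.1 ht), hy₀p⟩
  refine ⟨sSup {c | ∃ y, Q c y}, x, ?_, ?_, ?_, ?_⟩
  · exact lt_of_lt_of_le (EReal.bot_lt_coe t₀) (le_sSup ⟨y₀, hQ₀⟩)
  · intro t ht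
    obtain ⟨c, ⟨y, hy⟩, htc⟩ := lt_sSup_iff.1 ht
    rw [hx hy htc]
    refine ⟨(hy.1 t htc).1, (hy.1 t htc).2.congr_of_eventuallyEq ?_⟩
    filter_upwards [hnear htc] with s hs using hx hy hs
  · refine hy₀p.congr' ?_
    filter_upwards [eventually_lt_atBot t₀] with t ht
    exact (hx hQ₀ (EReal.coe_lt_coe_iff.2 ht)).symm
  · intro c y hy hyp
    exact ⟨le_sSup ⟨y, hy, hyp⟩, fun t ht => (hx ⟨hy, hyp⟩ ht).symm⟩

end Pullback

/-! ### Trapping and capture under a varying parameter -/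

section Capture

variable {n : ℕ} {U : Set (Space n)} {f : Space n → ℝ → Space n} {l : ℝ} {p : Space n}

theorem continuousAt_param (hU : IsOpen U)
    (hf : ContDiffOn ℝ 2 (fun q : Space n × ℝ => f q.1 q.2) (U ×ˢ univ)) (hp : p ∈ U) (m : ℝ) :
    ContinuousAt (fun m => f p m) m :=
  ContinuousAt.comp (f := fun m : ℝ => (p, m))
    (hf.contDiffAt ((hU.prod isOpen_univ).mem_nhds ⟨hp, mem_univ m⟩)).continuousAt (by fun_prop)

theorem SolvesOn.comp_const_add {μ : ℝ → ℝ} {x : ℝ → Space n} {a b : ℝ} (h : SolvesOn f μ a b x)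
    (d : ℝ) : SolvesOn f (fun t => μ (d + t)) (a - d) (b - d) (fun t => x (d + t)) := by
  refine ⟨h.continuousOn.comp (by fun_prop) fun t ht => ⟨by linarith [ht.1], by linarith [ht.2]⟩,
    fun t ht => ?_⟩
  have h1 := h.hasDeriv (d + t) ⟨by linarith [ht.1], by linarith [ht.2]⟩
  have h2 : HasDerivWithinAt (fun t => d + t) 1 (Ici t) t :=
    ((hasDerivAt_id t).const_add d).hasDerivWithinAt
  have h3 := h1.scomp t h2 (fun s hs => by simpa using hs)
  rw [one_smul] at h3
  exact h3

/-- Solutions starting near an attracting equilibrium stay near it, as long as the parameter does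
not move too far. -/
theorem IsAttractingEquilibrium.trap (hU : IsOpen U)
    (hf : ContDiffOn ℝ 2 (fun q : Space n × ℝ => f q.1 q.2) (U ×ˢ univ))
    (hp : IsAttractingEquilibrium U f l p) {η : ℝ} (hη : 0 < η) :
    ∃ δ > 0, ∀ (μ : ℝ → ℝ) (x : ℝ → Space n) (a b : ℝ), SolvesOn f μ a b x →
      (∀ t ∈ Ico a b, |μ t - l| ≤ δ) → ‖x a - p‖ ≤ δ → ∀ t ∈ Icc a b, ‖x t - p‖ ≤ η := by
  obtain ⟨P, c, ρ, hLC⟩ := hp.exists_isLocalContraction hU hf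
  exact hLC.trap hp.eq_zero (continuousAt_param hU hf hp.mem l) hη

/-- A solution emanating from an attracting equilibrium at `-∞` stays near it, as long as the
parameter does not move too far. -/
theorem IsAttractingEquilibrium.trap_atBot (hU : IsOpen U)
    (hf : ContDiffOn ℝ 2 (fun q : Space n × ℝ => f q.1 q.2) (U ×ˢ univ))
    (hp : IsAttractingEquilibrium U f l p) {η : ℝ} (hη : 0 < η) :
    ∃ δ > 0, ∀ (μ : ℝ → ℝ) (x : ℝ → Space n) (t : ℝ), (∀ a ≤ t, SolvesOn f μ a t x) →
      (∀ s < t, |μ s - l| ≤ δ) → Tendsto x atBot (𝓝 p) → ‖x t - p‖ ≤ η := by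
  obtain ⟨δ, hδ, h⟩ := hp.trap hU hf hη
  refine ⟨δ, hδ, fun μ x t hx hμ hxp => ?_⟩
  obtain ⟨a, ha, hat⟩ := ((Metric.tendsto_nhds.1 hxp δ hδ).and (eventually_le_atBot t)).exists
  exact h μ x a t (hx a hat) (fun s hs => hμ s hs.2) (by rw [← dist_eq_norm]; exact ha.le) t
    ⟨hat, le_rfl⟩

/-- Solutions starting near a point of the basin of an attracting equilibrium get close to that
equilibrium and stay there, as long as the parameter does not move too far. -/
theorem IsAttractingEquilibrium.capture (hU : IsOpen U)
    (hf : ContDiffOn ℝ 2 (fun q : Space n × ℝ => f q.1 q.2) (U ×ˢ univ))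
    (hp : IsAttractingEquilibrium U f l p) {q : Space n} (hq : q ∈ basin U f l p)
    {η : ℝ} (hη : 0 < η) :
    ∃ T > 0, ∃ δ > 0, ∀ (μ : ℝ → ℝ) (x : ℝ → Space n) (a b : ℝ), a + T ≤ b → SolvesOn f μ a b x →
      (∀ t ∈ Ico a b, |μ t - l| ≤ δ) → ‖x a - q‖ ≤ δ →
      ∀ t ∈ Icc (a + T) b, ‖x t - p‖ ≤ η := by
  obtain ⟨δ₁, hδ₁, htrap⟩ := hp.trap hU hf hη
  obtain ⟨z, hz0, hz, hzp⟩ := hq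
  -- Half of the trapping radius δ₁ goes to the reference solution z at time T, the other half to
  -- the deviation of x from z.
  obtain ⟨T, hT, hT0⟩ :=
    ((Metric.tendsto_nhds.1 hzp (δ₁ / 2) (by positivity)).and (eventually_gt_atTop 0)).exists
  obtain ⟨δ₂, hδ₂, C, -, hcmp⟩ := exists_forall_norm_sub_le hU hf (SolvesOn.of_forward hz T)
    (fun t ht => (hz t ht.1).1) (R := |l|) (fun _ _ => le_rfl) (half_pos hδ₁)
  refine ⟨T, hT0, min δ₁ δ₂, lt_min hδ₁ hδ₂, ?_⟩
  intro μ x a b hab hx hμ hxa t ht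
  have hx' := (hx.comp_const_add a).mono (a' := 0) (b' := T) (by simp) (by linarith)
  have h1 := hcmp δ₂ hδ₂ le_rfl _ _ hx'
    (fun s hs => (hμ _ ⟨by linarith [hs.1], by linarith [hs.2]⟩).trans (min_le_right _ _))
    (by rw [add_zero, hz0]; exact hxa.trans (min_le_right _ _)) T ⟨hT0.le, le_rfl⟩
  have h2 : ‖x (a + T) - p‖ ≤ δ₁ := by
    have h3 := h1.trans (min_le_left _ _)
    rw [dist_eq_norm] at hT
    calc _ ≤ ‖x (a + T) - z T‖ + ‖z T - p‖ := norm_sub_le_norm_sub_add_norm_sub _ _ _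
      _ ≤ δ₁ := by linarith
  exact htrap μ x (a + T) b (hx.mono (by linarith) le_rfl)
    (fun s hs => (hμ s ⟨by linarith [hs.1], hs.2⟩).trans (min_le_left _ _)) h2 t ht

end Capture

/-! ### Fast shifts and the second claim -/

section Shift

variable {n : ℕ} {U : Set (Space n)} {f : Space n → ℝ → Space n} {Λ : ℝ → ℝ} {lm lp : ℝ}
  {X : ℝ → Space n} {Xm Xp Yp : Space n}

theorem IsParameterShift.abs_le (hΛ : IsParameterShift Λ lm lp) (s : ℝ) :
    |Λ s| ≤ max |lm| |lp| := by
  have h := hΛ.mem_Ioo s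
  exact abs_le_max_abs_abs h.1.le h.2.le

theorem IsParameterShift.exists_near_atBot (hΛ : IsParameterShift Λ lm lp) {δ : ℝ} (hδ : 0 < δ) :
    ∃ K, ∀ s ≤ K, |Λ s - lm| ≤ δ := by
  obtain ⟨K, hK⟩ := eventually_atBot.1 (Metric.tendsto_nhds.1 hΛ.tendsto_atBot δ hδ)
  exact ⟨K, fun s hs => (Real.dist_eq _ _ ▸ hK s hs).le⟩

theorem IsParameterShift.exists_near_atTop (hΛ : IsParameterShift Λ lm lp) {δ : ℝ} (hδ : 0 < δ) :
    ∃ K, ∀ s ≥ K, |Λ s - lp| ≤ δ := by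
  obtain ⟨K, hK⟩ := eventually_atTop.1 (Metric.tendsto_nhds.1 hΛ.tendsto_atTop δ hδ)
  exact ⟨K, fun s hs => (Real.dist_eq _ _ ▸ hK s hs).le⟩

/-- If there is no tipping, the local pullback attractor is a global solution that connects `Xm`
to `Xp`. -/
theorem exists_connection_of_not_rTips (hU : IsOpen U)
    (hf : ContDiffOn ℝ 2 (fun q : Space n × ℝ => f q.1 q.2) (U ×ˢ univ))
    (hΛ : IsParameterShift Λ lm lp) (hXm : IsAttractingEquilibrium U f lm Xm) {r : ℝ} (hr : 0 < r)
    (h : ¬ RTips U f Λ r Xm Xp) :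
    ∃ x : ℝ → Space n, (∀ a b, SolvesOn f (fun t => Λ (r * t)) a b x) ∧ Tendsto x atBot (𝓝 Xm) ∧
      Tendsto x atTop (𝓝 Xp) := by
  obtain ⟨b, x, hx⟩ := exists_isPullbackAttractor hU hf hXm hΛ.contDiff.continuous
    (hΛ.tendsto_atBot.comp (tendsto_id.const_mul_atBot hr))
  have hb : b = ⊤ ∧ Tendsto x atTop (𝓝 Xp) := by
    by_contra hne
    exact h ⟨b, x, hx, hne⟩
  refine ⟨x, fun a d => hx.trajectory.solvesOn ?_, hx.tendsto_atBot, hb.2⟩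
  rw [hb.1]
  exact EReal.coe_lt_top d

/-- A limit of points that stay at distance at most `‖q - p‖ / 2` from `q` is not `p`. -/
theorem not_tendsto_of_norm_sub_le {p q : Space n} (hpq : q ≠ p) {x : ℝ → Space n}
    (hx : Tendsto x atTop (𝓝 p)) {K : ℝ} (h : ∀ t ≥ K, ‖x t - q‖ ≤ ‖q - p‖ / 2) : False := by
  have h1 := le_of_tendsto (hx.sub_const q).norm ((eventually_ge_atTop K).mono h)
  have h2 : 0 < ‖q - p‖ := norm_pos_iff.2 (sub_ne_zero.2 hpq)
  rw [norm_sub_rev] at h1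
  linarith

/-- X_- is in the closure of every past piece of X, so stability would make its frozen orbit
converge to X s. For large s capture holds that orbit in a ball about Y_+, which puts X s there too
and contradicts X s → X_+. -/
theorem not_isForwardBasinStable_of_mem_basin_limit (hU : IsOpen U)
    (hf : ContDiffOn ℝ 2 (fun q : Space n × ℝ => f q.1 q.2) (U ×ˢ univ))
    (hΛ : IsParameterShift Λ lm lp) (hXm : Tendsto X atBot (𝓝 Xm)) (hXp : Tendsto X atTop (𝓝 Xp))
    (hYp : IsAttractingEquilibrium U f lp Yp) (hne : Yp ≠ Xp) (hbasin : Xm ∈ basin U f lp Yp) :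
    ¬ IsForwardBasinStable U f Λ X := by
  intro hFBS
  have hη : 0 < ‖Yp - Xp‖ / 2 := half_pos (norm_pos_iff.2 (sub_ne_zero.2 hne))
  obtain ⟨T, hT, δ, hδ, hcap⟩ := hYp.capture hU hf hbasin hη
  obtain ⟨K, hK⟩ := hΛ.exists_near_atTop hδ
  refine not_tendsto_of_norm_sub_le hne hXp (K := K) fun s hs => ?_
  have hmem : Xm ∈ closure (X '' Iio s) :=
    mem_closure_of_tendsto hXm ((eventually_lt_atBot s).mono fun t ht => ⟨t, ht, rfl⟩)
  obtain ⟨w, hw0, hw, hwX⟩ := hFBS s hmem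
  refine le_of_tendsto (hwX.sub_const Yp).norm ?_
  filter_upwards [eventually_ge_atTop T] with t ht
  exact hcap (fun _ => Λ s) w 0 t (by linarith) (SolvesOn.of_forward hw t) (fun _ _ => hK s hs)
    (by rw [hw0, sub_self, norm_zero]; exact hδ.le) t ⟨by linarith, le_rfl⟩

/-- Fast shifts tip when the past equilibrium lies in the basin of another future equilibrium. -/
theorem exists_forall_rTips_of_mem_basin_limit (hU : IsOpen U)
    (hf : ContDiffOn ℝ 2 (fun q : Space n × ℝ => f q.1 q.2) (U ×ˢ univ))
    (hΛ : IsParameterShift Λ lm lp) (hXm : IsAttractingEquilibrium U f lm Xm)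
    (hYp : IsAttractingEquilibrium U f lp Yp) (hne : Yp ≠ Xp) (hbasin : Xm ∈ basin U f lp Yp) :
    ∃ r₀ : ℝ, 0 < r₀ ∧ ∀ r : ℝ, r₀ < r → RTips U f Λ r Xm Xp := by
  have hη : 0 < ‖Yp - Xp‖ / 2 := half_pos (norm_pos_iff.2 (sub_ne_zero.2 hne))
  -- The tolerances are chosen backwards in time: δ₁ for capture, δ₂ for the passage, δ₃ for the
  -- past. The passage from s₁ to s₂ takes time (s₂ - s₁) / r, which is below δ₂ exactly when r >
  -- r₀.
  obtain ⟨T, hT, δ₁, hδ₁, hcap⟩ := hYp.capture hU hf hbasin hη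
  obtain ⟨δ₂, hδ₂, hshort⟩ :=
    exists_forall_norm_sub_le_of_short hU hf hXm.mem (max |lm| |lp|) hδ₁
  obtain ⟨δ₃, hδ₃, hpast⟩ := hXm.trap_atBot hU hf hδ₂
  obtain ⟨s₁, hs₁⟩ := hΛ.exists_near_atBot hδ₃
  obtain ⟨K, hK⟩ := hΛ.exists_near_atTop hδ₁
  set s₂ := max K (s₁ + 1) with hs₂
  have hs12 : s₁ + 1 ≤ s₂ := le_max_right _ _
  have hr₀ : 0 < (s₂ - s₁) / δ₂ := div_pos (by linarith) hδ₂
  refine ⟨(s₂ - s₁) / δ₂, hr₀, fun r hr => ?_⟩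
  have hr0 : 0 < r := hr₀.trans hr
  by_contra hnot
  obtain ⟨x, hx, hxm, hxp⟩ := exists_connection_of_not_rTips hU hf hΛ hXm hr0 hnot
  have h1 : ‖x (s₁ / r) - Xm‖ ≤ δ₂ := by
    refine hpast _ x (s₁ / r) (fun a _ => hx a _) (fun s hs => hs₁ _ ?_) hxm
    rw [mul_comm]
    exact ((lt_div_iff₀ hr0).1 hs).le
  have h12 : s₁ / r ≤ s₂ / r := by gcongr; linarith
  have h2 : ‖x (s₂ / r) - Xm‖ ≤ δ₁ := by
    refine hshort _ x (s₁ / r) (s₂ / r) (hx _ _) (fun t _ => hΛ.abs_le _) h1 ?_ _ ⟨h12, le_rfl⟩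
    rw [← sub_div, div_le_iff₀ hr0]
    have := (div_lt_iff₀ hδ₂).1 hr
    linarith
  refine not_tendsto_of_norm_sub_le hne hxp (K := s₂ / r + T) fun t ht => ?_
  refine hcap _ x (s₂ / r) t ht (hx _ _) (fun s hs => hK _ ?_) h2 t ⟨ht, le_rfl⟩
  have h3 := (div_le_iff₀ hr0).1 hs.1
  rw [mul_comm]
  exact (le_max_left _ _).trans h3

end Shift

/-! ### The slow–fast reparametrization -/

section Transition

/-- The reparametrization that moves slowly, with speed `ε`, except for a fast transition of
duration `ε` from `u` to `v`. -/
noncomputable def slowFast (u v ε t : ℝ) : ℝ :=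
  u + ε * t + (v - u) * Real.smoothTransition (t / ε)

variable {u v ε : ℝ}

theorem slowFast_of_nonpos (hε : 0 < ε) {t : ℝ} (ht : t ≤ 0) : slowFast u v ε t = u + ε * t := by
  rw [slowFast, Real.smoothTransition.zero_of_nonpos (div_nonpos_of_nonpos_of_nonneg ht hε.le)]
  ring

theorem slowFast_of_le (hε : 0 < ε) {t : ℝ} (ht : ε ≤ t) : slowFast u v ε t = v + ε * t := by
  rw [slowFast, Real.smoothTransition.one_of_one_le ((one_le_div hε).2 ht)]
  ring

theorem slowFast_contDiff : ContDiff ℝ 2 (slowFast u v ε) := by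
  have h : ContDiff ℝ 2 fun t : ℝ => Real.smoothTransition (t / ε) :=
    Real.smoothTransition.contDiff.comp (by fun_prop)
  unfold slowFast
  fun_prop

theorem slowFast_deriv_pos (huv : u < v) (hε : 0 < ε) (t : ℝ) : 0 < deriv (slowFast u v ε) t := by
  have h : Differentiable ℝ fun t : ℝ => Real.smoothTransition (t / ε) :=
    ((Real.smoothTransition.contDiff (n := 1)).comp
      (by fun_prop : ContDiff ℝ 1 fun t : ℝ => t / ε)).differentiable (by norm_num)
  have hmono : Monotone fun t : ℝ => Real.smoothTransition (t / ε) :=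
    fun a b hab => Real.smoothTransition.monotone (by gcongr)
  have h1 : HasDerivAt (slowFast u v ε)
      (ε * 1 + (v - u) * deriv (fun t : ℝ => Real.smoothTransition (t / ε)) t) t :=
    (((hasDerivAt_id t).const_mul ε).const_add u).add ((h t).hasDerivAt.const_mul (v - u))
  rw [h1.deriv]
  have h2 := mul_nonneg (sub_nonneg.2 huv.le) (hmono.deriv_nonneg (x := t))
  linarith

theorem slowFast_eventuallyEq_atBot (hε : 0 < ε) :
    slowFast u v ε =ᶠ[atBot] fun t => u + ε * t := by
  filter_upwards [eventually_le_atBot 0] with t ht using slowFast_of_nonpos hε ht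

theorem slowFast_eventuallyEq_atTop (hε : 0 < ε) :
    slowFast u v ε =ᶠ[atTop] fun t => v + ε * t := by
  filter_upwards [eventually_ge_atTop ε] with t ht using slowFast_of_le hε ht

theorem slowFast_isReparametrization (huv : u < v) (hε : 0 < ε) :
    IsReparametrization (slowFast u v ε) where
  contDiff := slowFast_contDiff
  deriv_pos := slowFast_deriv_pos huv hε
  tendsto_atBot := (tendsto_atBot_add_const_left _ u (tendsto_id.const_mul_atBot hε)).congr'
    (slowFast_eventuallyEq_atBot hε).symm
  tendsto_atTop := (tendsto_atTop_add_const_left _ v (tendsto_id.const_mul_atTop hε)).congr'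
    (slowFast_eventuallyEq_atTop hε).symm

/-- Outside [0, ε] the reparametrization is affine of slope ε, so at both ends the new derivative is
ε times the old one at the image point. -/
theorem IsParameterShift.comp_slowFast {Λ : ℝ → ℝ} {lm lp : ℝ} (hΛ : IsParameterShift Λ lm lp)
    (huv : u < v) (hε : 0 < ε) : IsParameterShift (Λ ∘ slowFast u v ε) lm lp := by
  have hσ := slowFast_isReparametrization huv hε
  have hderiv : ∀ t, deriv (Λ ∘ slowFast u v ε) t =
      deriv Λ (slowFast u v ε t) * deriv (slowFast u v ε) t := fun t =>
    deriv_comp t (hΛ.contDiff.differentiable (by norm_num) _)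
      (slowFast_contDiff.differentiable (by norm_num) t)
  have haff : ∀ w t : ℝ, deriv (fun t => w + ε * t) t = ε := fun w t => by simp
  refine ⟨hΛ.contDiff.comp slowFast_contDiff, fun s => hΛ.mem_Ioo _,
    hΛ.tendsto_atBot.comp hσ.tendsto_atBot, hΛ.tendsto_atTop.comp hσ.tendsto_atTop, ?_, ?_⟩
  · have h1 := (hΛ.deriv_atBot.comp hσ.tendsto_atBot).mul_const ε
    rw [zero_mul] at h1
    refine h1.congr' ?_
    filter_upwards [eventually_lt_atBot 0] with t ht
    have h2 : slowFast u v ε =ᶠ[𝓝 t] fun t => u + ε * t := by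
      filter_upwards [Iio_mem_nhds ht] with s hs using slowFast_of_nonpos hε (le_of_lt hs)
    rw [hderiv, h2.deriv_eq, haff]
    rfl
  · have h1 := (hΛ.deriv_atTop.comp hσ.tendsto_atTop).mul_const ε
    rw [zero_mul] at h1
    refine h1.congr' ?_
    filter_upwards [eventually_gt_atTop ε] with t ht
    have h2 : slowFast u v ε =ᶠ[𝓝 t] fun t => v + ε * t := by
      filter_upwards [Ioi_mem_nhds ht] with s hs using slowFast_of_le hε (le_of_lt hs)
    rw [hderiv, h2.deriv_eq, haff]
    rfl

end Transition

/-! ### Adiabatic tracking and the first claim -/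

section Tracking

/-- Propagation of a property along an interval by local steps to the right. -/
theorem propagate_Icc {Q : ℝ → Prop} {a b : ℝ} (hab : a ≤ b) (ha : Q a)
    (hstep : ∀ s ∈ Icc a b, ∃ κ > 0, ∀ s₁ s₂, a ≤ s₁ → s₁ < s₂ → s₂ ≤ b → |s₁ - s| < κ →
      |s₂ - s| < κ → Q s₁ → Q s₂) : Q b := by
  set S := {s | s ∈ Icc a b ∧ Q s} with hS
  have haS : a ∈ S := ⟨⟨le_rfl, hab⟩, ha⟩
  have hbdd : BddAbove S := ⟨b, fun s hs => hs.1.2⟩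
  have hca : a ≤ sSup S := le_csSup hbdd haS
  have hcb : sSup S ≤ b := csSup_le ⟨a, haS⟩ fun s hs => hs.1.2
  obtain ⟨κ, hκ, hst⟩ := hstep (sSup S) ⟨hca, hcb⟩
  -- Q need not hold at the supremum: the step starts at a point of S close to it and jumps past it.
  obtain ⟨s₁, hs₁, hlt⟩ := exists_lt_of_lt_csSup ⟨a, haS⟩ (sub_lt_self (sSup S) hκ)
  have hle : s₁ ≤ sSup S := le_csSup hbdd hs₁
  have habs : |s₁ - sSup S| < κ := abs_sub_lt_iff.2 ⟨by linarith, by linarith⟩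
  by_cases hb : b < sSup S + κ
  · rcases (hs₁.1.2).eq_or_lt with rfl | h
    · exact hs₁.2
    · exact hst s₁ b hs₁.1.1 h le_rfl habs (abs_sub_lt_iff.2 ⟨by linarith, by linarith⟩) hs₁.2
  · push Not at hb
    have h2 : Q (sSup S + κ / 2) := hst s₁ (sSup S + κ / 2) hs₁.1.1 (by linarith) (by linarith)
      habs (by rw [add_sub_cancel_left, abs_of_pos (half_pos hκ)]; linarith) hs₁.2
    have h3 := le_csSup hbdd (a := sSup S + κ / 2) ⟨⟨by linarith, by linarith⟩, h2⟩
    linarith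

variable {n : ℕ} {U : Set (Space n)} {f : Space n → ℝ → Space n} {Λ : ℝ → ℝ}

/-- A slowly driven solution that starts near an attracting equilibrium `p` relaxes to the
equilibrium `q` for the current parameter value, as long as the parameter stays near its value
at `p`. -/
theorem IsAttractingEquilibrium.exists_tendsto_of_slow (hU : IsOpen U)
    (hf : ContDiffOn ℝ 2 (fun q : Space n × ℝ => f q.1 q.2) (U ×ˢ univ)) (hΛ : Continuous Λ)
    {l : ℝ} {p : Space n} (hp : IsAttractingEquilibrium U f l p) (w : ℝ)
    (x : ℝ → ℝ → Space n) :
    ∃ ρ > 0, ∀ (τ : ℝ → ℝ) (s : ℝ) (q : Space n), |Λ s - l| ≤ ρ → ‖q - p‖ ≤ ρ → q ∈ U →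
      f q (Λ s) = 0 → Tendsto (fun ε => (s - w) / ε - τ ε) (𝓝[>] 0) atTop →
      (∀ᶠ ε in 𝓝[>] 0, SolvesOn f (fun t => Λ (w + ε * t)) (τ ε) ((s - w) / ε) (x ε) ∧
        (∀ t ∈ Ico (τ ε) ((s - w) / ε), |Λ (w + ε * t) - l| ≤ ρ) ∧ ‖x ε (τ ε) - p‖ ≤ ρ) →
      Tendsto (fun ε => x ε ((s - w) / ε)) (𝓝[>] 0) (𝓝 q) := by
  obtain ⟨P, c, ρ, hLC⟩ := hp.exists_isLocalContraction hU hf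
  have hρ := hLC.radius_pos
  obtain ⟨δ, hδ, htrap⟩ := hLC.trap hp.eq_zero (continuousAt_param hU hf hp.mem l) hρ
  refine ⟨min δ (ρ / 2), lt_min hδ (half_pos hρ), ?_⟩
  intro τ s q hs hq hqU hfq hτ hev
  rw [Metric.tendsto_nhds]
  intro η hη
  obtain ⟨T, hT, δ', hδ', hatt⟩ := hLC.attract (p₂ := q) (l₂ := Λ s)
    (hq.trans ((min_le_right _ _).trans (by linarith)))
    ((hs.trans (min_le_right _ _)).trans_lt (by linarith)) hfq
    (continuousAt_param hU hf hqU _) (half_pos hη)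
  obtain ⟨κ, hκ, hΛκ⟩ := Metric.continuousAt_iff.1 (hΛ.continuousAt (x := s)) δ' hδ'
  -- During the last T units of time the parameter time moves only εT < κ, so Λ stays within δ' of Λ
  -- s while x relaxes to q.
  have hsmall : Ioo (0 : ℝ) (κ / (T + 1)) ∈ 𝓝[>] (0 : ℝ) := Ioo_mem_nhdsGT (by positivity)
  filter_upwards [hev, hτ.eventually_ge_atTop T, hsmall] with ε ⟨hsol, hpar, hstart⟩ hτε hεI
  have hε : 0 < ε := hεI.1
  have hρ' : ∀ t ∈ Icc (τ ε) ((s - w) / ε), ‖x ε t - p‖ ≤ ρ :=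
    htrap _ (x ε) (τ ε) _ hsol (fun t ht => (hpar t ht).trans (min_le_left _ _))
      (hstart.trans (min_le_left _ _))
  have hsub : (s - w) / ε - T + T = (s - w) / ε := by ring
  have h1 := hatt (fun t => Λ (w + ε * t)) (x ε) ((s - w) / ε - T)
    (by rw [hsub]; exact hsol.mono (by linarith) le_rfl)
    (by
      rw [hsub]
      intro t ht
      have h2 : s - ε * T ≤ w + ε * t := by
        have h3 := mul_le_mul_of_nonneg_left ht.1 hε.le
        have h4 : ε * ((s - w) / ε - T) = s - w - ε * T := by field_simp
        linarith
      have h5 : w + ε * t ≤ s := by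
        have h6 := (le_div_iff₀ hε).1 ht.2.le
        linarith
      have h7 : ε * T < κ := by
        have h8 := (lt_div_iff₀ (by positivity)).1 hεI.2
        nlinarith
      have := hΛκ (x := w + ε * t)
        (by rw [Real.dist_eq]; exact abs_sub_lt_iff.2 ⟨by linarith, by linarith⟩)
      rw [Real.dist_eq] at this
      exact this.le)
    (by
      rw [hsub]
      intro t ht
      exact hρ' t ⟨by linarith [ht.1], ht.2⟩)
  rw [hsub] at h1
  rw [dist_eq_norm]
  linarith

/-- A fixed gap in parameter time becomes an arbitrarily long stretch of actual time as ε → 0,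
leaving room for relaxation. -/
theorem tendsto_sub_div_sub_div {s₁ s₂ : ℝ} (h : s₁ < s₂) (w : ℝ) :
    Tendsto (fun ε : ℝ => (s₂ - w) / ε - (s₁ - w) / ε) (𝓝[>] 0) atTop := by
  have h1 : Tendsto (fun ε : ℝ => (s₂ - s₁) * ε⁻¹) (𝓝[>] 0) atTop :=
    tendsto_inv_nhdsGT_zero.const_mul_atTop (sub_pos.2 h)
  refine h1.congr fun ε => ?_
  rw [← sub_div, sub_sub_sub_cancel_right, div_eq_mul_inv]

/-- Adiabatic tracking: a slowly driven solution that is close to a stable path at parameter time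
`a` is close to it at parameter time `b ≥ a`. -/
theorem IsStablePath.tendsto_of_slow (hU : IsOpen U)
    (hf : ContDiffOn ℝ 2 (fun q : Space n × ℝ => f q.1 q.2) (U ×ˢ univ)) (hΛ : Continuous Λ)
    {Z : ℝ → Space n} (hZ : IsStablePath U f Λ Z) {w a b : ℝ} (hab : a ≤ b)
    {x : ℝ → ℝ → Space n}
    (hx : ∀ᶠ ε in 𝓝[>] 0, SolvesOn f (fun t => Λ (w + ε * t)) ((a - w) / ε) ((b - w) / ε) (x ε))
    (ha : Tendsto (fun ε => x ε ((a - w) / ε)) (𝓝[>] 0) (𝓝 (Z a))) :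
    Tendsto (fun ε => x ε ((b - w) / ε)) (𝓝[>] 0) (𝓝 (Z b)) := by
  refine propagate_Icc (Q := fun s => Tendsto (fun ε => x ε ((s - w) / ε)) (𝓝[>] 0) (𝓝 (Z s)))
    hab ha fun s _ => ?_
  obtain ⟨ρ, hρ, hstep⟩ := (hZ.attracting s).exists_tendsto_of_slow hU hf hΛ w x
  obtain ⟨κ₁, hκ₁, h₁⟩ := Metric.continuousAt_iff.1 (hΛ.continuousAt (x := s)) ρ hρ
  obtain ⟨κ₂, hκ₂, h₂⟩ := Metric.continuousAt_iff.1 (hZ.continuous.continuousAt (x := s)) ρ hρ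
  refine ⟨min κ₁ κ₂, lt_min hκ₁ hκ₂, fun s₁ s₂ has₁ hs₁₂ hs₂b hd₁ hd₂ hQ => ?_⟩
  have hΛs : ∀ s', |s' - s| < min κ₁ κ₂ → |Λ s' - Λ s| ≤ ρ := fun s' h => by
    have := h₁ (x := s') (by rw [Real.dist_eq]; exact h.trans_le (min_le_left _ _))
    rw [Real.dist_eq] at this
    exact this.le
  have hZs : ∀ s', |s' - s| < min κ₁ κ₂ → ‖Z s' - Z s‖ < ρ := fun s' h => by
    have := h₂ (x := s') (by rw [Real.dist_eq]; exact h.trans_le (min_le_right _ _))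
    rwa [dist_eq_norm] at this
  refine hstep (fun ε => (s₁ - w) / ε) s₂ (Z s₂) (hΛs s₂ hd₂) (hZs s₂ hd₂).le
    (hZ.attracting s₂).mem (hZ.attracting s₂).eq_zero (tendsto_sub_div_sub_div hs₁₂ w) ?_
  have hnear := (hQ.sub_const (Z s)).norm.eventually (gt_mem_nhds (hZs s₁ hd₁))
  filter_upwards [hx, hnear, self_mem_nhdsWithin] with ε hsol hn hε
  have hε : 0 < ε := hε
  refine ⟨hsol.mono (by gcongr) (by gcongr), fun t ht => hΛs _ ?_, hn.le⟩
  have e1 := (div_le_iff₀ hε).1 ht.1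
  have e2 := (lt_div_iff₀ hε).1 ht.2
  rw [abs_sub_lt_iff] at hd₁ hd₂ ⊢
  exact ⟨by linarith [hd₂.1], by linarith [hd₁.2]⟩

variable {lm lp : ℝ} {X Y : ℝ → Space n} {Xm Xp Yp : Space n} {u v : ℝ}

/-- Two stable paths that meet coincide. -/
theorem IsStablePath.eq_of_apply_eq (hU : IsOpen U)
    (hf : ContDiffOn ℝ 2 (fun q : Space n × ℝ => f q.1 q.2) (U ×ˢ univ)) (hΛ : Continuous Λ)
    (hX : IsStablePath U f Λ X) (hY : IsStablePath U f Λ Y) (h : X v = Y v) : X = Y := by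
  have hclosed : IsClosed {s | X s = Y s} := isClosed_eq hX.continuous hY.continuous
  -- Contraction makes the equilibrium near X s unique for each nearby parameter, so the coincidence
  -- set is open as well as closed.
  have hopen : IsOpen {s | X s = Y s} := by
    rw [isOpen_iff_mem_nhds]
    intro s hs
    obtain ⟨P, c, ρ, hLC⟩ := (hX.attracting s).exists_isLocalContraction hU hf
    have h1 := Metric.tendsto_nhds.1 (hX.continuous.tendsto s) ρ hLC.radius_pos
    have h2 := Metric.tendsto_nhds.1 (hY.continuous.tendsto s) ρ hLC.radius_pos
    have h3 := Metric.tendsto_nhds.1 (hΛ.tendsto s) ρ hLC.radius_pos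
    rw [← show X s = Y s from hs] at h2
    filter_upwards [h1, h2, h3] with t e1 e2 e3
    rw [dist_eq_norm] at e1 e2
    rw [Real.dist_eq] at e3
    exact hLC.eq_of_eq_zero e3.le e1.le e2.le (hX.attracting t).eq_zero (hY.attracting t).eq_zero
  have huniv := IsClopen.eq_univ ⟨hclosed, hopen⟩ ⟨v, h⟩
  funext s
  have : s ∈ {s | X s = Y s} := huniv ▸ mem_univ s
  exact this

/-- A point lies in at most one basin for a given parameter, so stability would force X v = Y v, and
paths that meet have equal limits. -/
theorem not_isForwardBasinStable_of_mem_basin (hU : IsOpen U)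
    (hf : ContDiffOn ℝ 2 (fun q : Space n × ℝ => f q.1 q.2) (U ×ˢ univ)) (hΛ : Continuous Λ)
    (hX : IsStablePath U f Λ X) (hXp : Tendsto X atTop (𝓝 Xp)) (hY : IsStablePath U f Λ Y)
    (hYp : Tendsto Y atTop (𝓝 Yp)) (hne : Yp ≠ Xp) (huv : u < v)
    (hbasin : X u ∈ basin U f (Λ v) (Y v)) : ¬ IsForwardBasinStable U f Λ X := by
  intro hFBS
  have h1 : X v = Y v :=
    eq_of_mem_basin hU hf (hFBS v (subset_closure ⟨u, huv, rfl⟩)) hbasin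
  have h2 := hX.eq_of_apply_eq hU hf hΛ hY h1
  subst h2
  exact hne (tendsto_nhds_unique hYp hXp)

/-- A pullback attractor of the slow–fast shift tracks the path `X` up to the fast transition. -/
theorem tendsto_before_transition (hU : IsOpen U)
    (hf : ContDiffOn ℝ 2 (fun q : Space n × ℝ => f q.1 q.2) (U ×ˢ univ))
    (hΛ : IsParameterShift Λ lm lp) (hX : IsStablePath U f Λ X) (hXm : Tendsto X atBot (𝓝 Xm))
    (hXm_attr : IsAttractingEquilibrium U f lm Xm) {x : ℝ → ℝ → Space n}
    (hx : ∀ ε > 0, ∀ a b, SolvesOn f (fun t => Λ (slowFast u v ε t)) a b (x ε))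
    (hxm : ∀ ε > 0, Tendsto (x ε) atBot (𝓝 Xm)) :
    Tendsto (fun ε => x ε 0) (𝓝[>] 0) (𝓝 (X u)) := by
  have hΛc := hΛ.contDiff.continuous
  have hsol : ∀ ε > 0, ∀ a b, b ≤ 0 → SolvesOn f (fun t => Λ (u + ε * t)) a b (x ε) :=
    fun ε hε a b hb => (hx ε hε a b).congr_param fun t ht => by
      rw [slowFast_of_nonpos hε (ht.2.le.trans hb)]
  obtain ⟨ρ, hρ, hstep⟩ := hXm_attr.exists_tendsto_of_slow hU hf hΛc u x
  obtain ⟨δ, hδ, hpast⟩ := hXm_attr.trap_atBot hU hf hρ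
  obtain ⟨K₁, hK₁⟩ := hΛ.exists_near_atBot (lt_min hρ hδ)
  obtain ⟨K₂, hK₂⟩ := eventually_atBot.1 (Metric.tendsto_nhds.1 hXm ρ hρ)
  set s := min (min K₁ K₂) u with hs
  have hsK₁ : s ≤ K₁ := (min_le_left _ _).trans (min_le_left _ _)
  have hsu : s ≤ u := min_le_right _ _
  have hnonpos : ∀ ε > 0, ∀ s' ≤ u, (s' - u) / ε ≤ 0 := fun ε hε s' h =>
    div_nonpos_of_nonpos_of_nonneg (sub_nonpos.2 h) hε.le
  have hbase : Tendsto (fun ε => x ε ((s - u) / ε)) (𝓝[>] 0) (𝓝 (X s)) := by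
    -- At parameter time s - 1 the solution is still trapped near X_-; the unit of parameter time up
    -- to s is where it relaxes to X s.
    refine hstep (fun ε => (s - 1 - u) / ε) s (X s) ((hK₁ s hsK₁).trans (min_le_left _ _)) ?_
      (hX.attracting s).mem (hX.attracting s).eq_zero
      (tendsto_sub_div_sub_div (sub_one_lt s) u) ?_
    · rw [← dist_eq_norm]
      exact (hK₂ s ((min_le_left _ _).trans (min_le_right _ _))).le
    · filter_upwards [self_mem_nhdsWithin] with ε hε
      have hε : 0 < ε := hε
      refine ⟨hsol ε hε _ _ (hnonpos ε hε s hsu), fun t ht => (hK₁ _ ?_).trans (min_le_left _ _),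
        ?_⟩
      · have := (lt_div_iff₀ hε).1 ht.2
        linarith
      · refine hpast (fun t => Λ (u + ε * t)) (x ε) _
          (fun a _ => hsol ε hε _ _ (hnonpos ε hε _ (by linarith)))
          (fun t ht => (hK₁ _ ?_).trans (min_le_right _ _)) (hxm ε hε)
        have := (lt_div_iff₀ hε).1 ht
        linarith
  have h1 := hX.tendsto_of_slow hU hf hΛc hsu (w := u) (x := x)
    (by
      filter_upwards [self_mem_nhdsWithin] with ε hε
      exact hsol ε hε _ _ (hnonpos ε hε u le_rfl)) hbase
  simpa using h1

/-- After the fast transition, solutions of the slow–fast shift that start near a point of the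
basin of `Y v` track the path `Y`. -/
theorem tendsto_after_transition (hU : IsOpen U)
    (hf : ContDiffOn ℝ 2 (fun q : Space n × ℝ => f q.1 q.2) (U ×ˢ univ))
    (hΛ : IsParameterShift Λ lm lp) (hY : IsStablePath U f Λ Y) {q : Space n} (hqU : q ∈ U)
    (hq : q ∈ basin U f (Λ v) (Y v)) {x : ℝ → ℝ → Space n}
    (hx : ∀ ε > 0, ∀ a b, SolvesOn f (fun t => Λ (slowFast u v ε t)) a b (x ε))
    (hx0 : Tendsto (fun ε => x ε 0) (𝓝[>] 0) (𝓝 q)) {s : ℝ} (hs : v < s) :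
    Tendsto (fun ε => x ε ((s - v) / ε)) (𝓝[>] 0) (𝓝 (Y s)) := by
  have hΛc := hΛ.contDiff.continuous
  have hsol : ∀ ε > 0, ∀ a b, ε ≤ a → SolvesOn f (fun t => Λ (v + ε * t)) a b (x ε) :=
    fun ε hε a b ha => (hx ε hε a b).congr_param fun t ht => by
      rw [slowFast_of_le hε (ha.trans ht.1)]
  obtain ⟨ρ, hρ, hstep⟩ := (hY.attracting v).exists_tendsto_of_slow hU hf hΛc v x
  obtain ⟨T, hT, δ₁, hδ₁, hcap⟩ := (hY.attracting v).capture hU hf hq hρ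
  obtain ⟨δ₂, hδ₂, hshort⟩ := exists_forall_norm_sub_le_of_short hU hf hqU (max |lm| |lp|) hδ₁
  obtain ⟨κ₁, hκ₁, hΛκ⟩ :=
    Metric.continuousAt_iff.1 (hΛc.continuousAt (x := v)) (min ρ δ₁) (lt_min hρ hδ₁)
  obtain ⟨κ₂, hκ₂, hYκ⟩ := Metric.continuousAt_iff.1 (hY.continuous.continuousAt (x := v)) ρ hρ
  have hΛv : ∀ s', v ≤ s' → s' < v + κ₁ → |Λ s' - Λ v| ≤ min ρ δ₁ := fun s' h h' => by
    have := hΛκ (x := s') (by rw [Real.dist_eq]; exact abs_sub_lt_iff.2 ⟨by linarith, by linarith⟩)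
    rw [Real.dist_eq] at this
    exact this.le
  set s₁ := min s (v + min κ₁ κ₂ / 2) with hs₁
  have hκ : 0 < min κ₁ κ₂ := lt_min hκ₁ hκ₂
  have hvs₁ : v < s₁ := lt_min hs (by linarith)
  have hs₁le : s₁ ≤ v + min κ₁ κ₂ / 2 := min_le_right _ _
  have hs₁κ₁ : s₁ < v + κ₁ := by linarith [min_le_left κ₁ κ₂]
  have hs₁κ₂ : s₁ < v + κ₂ := by linarith [min_le_right κ₁ κ₂]
  have hlim : Tendsto (fun ε : ℝ => (s₁ - v) / ε - (ε + T)) (𝓝[>] 0) atTop := by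
    have h1 : Tendsto (fun ε : ℝ => (s₁ - v) * ε⁻¹) (𝓝[>] 0) atTop :=
      tendsto_inv_nhdsGT_zero.const_mul_atTop (sub_pos.2 hvs₁)
    refine tendsto_atTop_mono' _ ?_ (tendsto_atTop_add_const_right _ (-(1 + T)) h1)
    filter_upwards [Ioo_mem_nhdsGT one_pos] with ε hε
    rw [div_eq_mul_inv]
    linarith [hε.2]
  have hbase : Tendsto (fun ε => x ε ((s₁ - v) / ε)) (𝓝[>] 0) (𝓝 (Y s₁)) := by
    -- Relaxation starts at time ε + T: ε for the jump, during which x stays within δ₁ of q, and T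
    -- for capture by Y v. For small ε the parameter has barely left Λ v by then.
    refine hstep (fun ε => ε + T) s₁ (Y s₁) ((hΛv s₁ hvs₁.le hs₁κ₁).trans (min_le_left _ _)) ?_
      (hY.attracting s₁).mem (hY.attracting s₁).eq_zero hlim ?_
    · have := hYκ (x := s₁)
        (by rw [Real.dist_eq]; exact abs_sub_lt_iff.2 ⟨by linarith, by linarith⟩)
      rw [dist_eq_norm] at this
      exact this.le
    · have hnear := Metric.tendsto_nhds.1 hx0 δ₂ hδ₂
      filter_upwards [hnear, Ioo_mem_nhdsGT hδ₂, Ioo_mem_nhdsGT one_pos,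
        Ioo_mem_nhdsGT (show 0 < κ₁ / (T + 1) by positivity)] with ε hn hεδ hε1 hεκ
      have hε : 0 < ε := hεδ.1
      have h1 : ‖x ε ε - q‖ ≤ δ₁ :=
        hshort _ (x ε) 0 ε (hx ε hε 0 ε) (fun t _ => hΛ.abs_le _)
          (by rw [← dist_eq_norm]; exact hn.le) (by linarith [hεδ.2]) ε ⟨hε.le, le_rfl⟩
      have hεT : ε * (T + 1) < κ₁ := (lt_div_iff₀ (by positivity)).1 hεκ.2
      refine ⟨hsol ε hε _ _ (by linarith), fun t ht => (hΛv _ ?_ ?_).trans (min_le_left _ _), ?_⟩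
      · have : 0 ≤ ε * t := mul_nonneg hε.le (by linarith [ht.1])
        linarith
      · have := (lt_div_iff₀ hε).1 ht.2
        linarith
      · refine hcap (fun t => Λ (v + ε * t)) (x ε) ε (ε + T) le_rfl (hsol ε hε _ _ le_rfl)
          (fun t ht => (hΛv _ ?_ ?_).trans (min_le_right _ _)) h1 _ ⟨le_rfl, le_rfl⟩
        · have : 0 ≤ ε * t := mul_nonneg hε.le (by linarith [ht.1])
          linarith
        · have : ε * t ≤ ε * (T + 1) := by
            gcongr
            linarith [ht.2, hε1.2]
          linarith
  refine hY.tendsto_of_slow hU hf hΛc (min_le_left _ _ : s₁ ≤ s) (w := v) (x := x) ?_ hbase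
  have h0 : 0 < s₁ - v := sub_pos.2 hvs₁
  filter_upwards [Ioo_mem_nhdsGT one_pos, Ioo_mem_nhdsGT h0] with ε hε1 hε2
  refine hsol ε hε1.1 _ _ ?_
  rw [le_div_iff₀ hε1.1]
  nlinarith [hε1.1, hε1.2, hε2.2]

/-- Some reparametrized shift tips when `X u` lies in the basin of `Y v` for some `u < v`. -/
theorem exists_reparametrization_rTips (hU : IsOpen U)
    (hf : ContDiffOn ℝ 2 (fun q : Space n × ℝ => f q.1 q.2) (U ×ˢ univ))
    (hΛ : IsParameterShift Λ lm lp) (hX : IsStablePath U f Λ X) (hXm : Tendsto X atBot (𝓝 Xm))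
    (hXm_attr : IsAttractingEquilibrium U f lm Xm) (hY : IsStablePath U f Λ Y)
    (hYlim : Tendsto Y atTop (𝓝 Yp)) (hYp : IsAttractingEquilibrium U f lp Yp) (hne : Yp ≠ Xp)
    (huv : u < v) (hbasin : X u ∈ basin U f (Λ v) (Y v)) :
    ∃ σ : ℝ → ℝ, IsReparametrization σ ∧ IsParameterShift (Λ ∘ σ) lm lp ∧
      ∃ r : ℝ, 0 < r ∧ RTips U f (Λ ∘ σ) r Xm Xp := by
  by_contra hnot
  -- Rate 1 suffices, since the speed is already built into the reparametrization.
  have hno : ∀ ε > 0, ¬ RTips U f (Λ ∘ slowFast u v ε) 1 Xm Xp := fun ε hε h =>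
    hnot ⟨_, slowFast_isReparametrization huv hε, hΛ.comp_slowFast huv hε, 1, one_pos, h⟩
  have hex : ∀ ε : ℝ, ∃ x : ℝ → Space n, 0 < ε →
      (∀ a b, SolvesOn f (fun t => Λ (slowFast u v ε t)) a b x) ∧ Tendsto x atBot (𝓝 Xm) ∧
      Tendsto x atTop (𝓝 Xp) := fun ε => by
    by_cases hε : 0 < ε
    · obtain ⟨x, h1, h2⟩ := exists_connection_of_not_rTips hU hf (hΛ.comp_slowFast huv hε)
        hXm_attr one_pos (hno ε hε)
      refine ⟨x, fun _ => ⟨fun a b => (h1 a b).congr_param fun t _ => ?_, h2⟩⟩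
      simp
    · exact ⟨fun _ => Xm, fun h => (hε h).elim⟩
  choose x hx using hex
  have hx0 := tendsto_before_transition hU hf hΛ hX hXm hXm_attr (fun ε hε => (hx ε hε).1)
    (fun ε hε => (hx ε hε).2.1)
  have hη : 0 < ‖Yp - Xp‖ / 2 := half_pos (norm_pos_iff.2 (sub_ne_zero.2 hne))
  obtain ⟨δ, hδ, htrap⟩ := hYp.trap hU hf hη
  obtain ⟨K₁, hK₁⟩ := hΛ.exists_near_atTop hδ
  obtain ⟨s, hYs, hsK, hvs⟩ := ((Metric.tendsto_nhds.1 hYlim δ hδ).and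
    ((eventually_ge_atTop K₁).and (eventually_gt_atTop v))).exists
  have hlim := tendsto_after_transition hU hf hΛ hY (hX.attracting u).mem hbasin
    (fun ε hε => (hx ε hε).1) hx0 hvs
  rw [dist_eq_norm] at hYs
  have hnear := (hlim.sub_const Yp).norm.eventually (gt_mem_nhds hYs)
  have h0 : 0 < s - v := sub_pos.2 hvs
  have hlt_one : ∀ᶠ ε in 𝓝[>] (0 : ℝ), ε ∈ Ioo 0 1 := Ioo_mem_nhdsGT one_pos
  have hlt_gap : ∀ᶠ ε in 𝓝[>] (0 : ℝ), ε ∈ Ioo 0 (s - v) := Ioo_mem_nhdsGT h0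
  obtain ⟨ε, hn, hε1, hε2⟩ := (hnear.and (hlt_one.and hlt_gap)).exists
  have hε : 0 < ε := hε1.1
  refine not_tendsto_of_norm_sub_le hne (hx ε hε).2.2 (K := (s - v) / ε) fun t ht => ?_
  refine htrap _ (x ε) ((s - v) / ε) t ((hx ε hε).1 _ _) (fun t' ht' => hK₁ _ ?_) hn.le t
    ⟨ht, le_rfl⟩
  have h2 := (div_le_iff₀ hε).1 ht'.1
  -- ε² ≤ s - v because ε < 1 and ε < s - v; hence time (s - v) / ε is past the jump and σ is affine
  -- from there on.
  have h3 : ε ≤ t' := by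
    refine le_trans ?_ ht'.1
    rw [le_div_iff₀ hε]
    nlinarith [hε1.2, hε2.2]
  rw [slowFast_of_le hε h3]
  linarith

end Tracking

end RateTipping

theorem theorem3p5 (n : ℕ) (U : Set (RateTipping.Space n)) (hU : IsOpen U)
    (f : RateTipping.Space n → ℝ → RateTipping.Space n)
    (hf : ContDiffOn ℝ 2 (fun q : RateTipping.Space n × ℝ => f q.1 q.2) (U ×ˢ Set.univ))
    (Λ : ℝ → ℝ) (lm lp : ℝ) (hΛ : RateTipping.IsParameterShift Λ lm lp)
    (X : ℝ → RateTipping.Space n) (hX : RateTipping.IsStablePath U f Λ X)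
    (Xm Xp : RateTipping.Space n)
    (hXm : Tendsto X atBot (𝓝 Xm)) (hXp : Tendsto X atTop (𝓝 Xp))
    (hXm_attr : RateTipping.IsAttractingEquilibrium U f lm Xm) :
    (∀ (Y : ℝ → RateTipping.Space n) (Yp : RateTipping.Space n),
      RateTipping.IsStablePath U f Λ Y →
      Tendsto Y atTop (𝓝 Yp) →
      RateTipping.IsAttractingEquilibrium U f lp Yp →
      Yp ≠ Xp →
      (∃ u v : ℝ, u < v ∧ X u ∈ RateTipping.basin U f (Λ v) (Y v)) →
      ¬ RateTipping.IsForwardBasinStable U f Λ X ∧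
      ∃ σ : ℝ → ℝ, RateTipping.IsReparametrization σ ∧
        RateTipping.IsParameterShift (Λ ∘ σ) lm lp ∧
        ∃ r : ℝ, 0 < r ∧ RateTipping.RTips U f (Λ ∘ σ) r Xm Xp) ∧
    (∀ Yp : RateTipping.Space n,
      RateTipping.IsAttractingEquilibrium U f lp Yp →
      Yp ≠ Xp →
      Xm ∈ RateTipping.basin U f lp Yp →
      ¬ RateTipping.IsForwardBasinStable U f Λ X ∧
      ∃ r₀ : ℝ, 0 < r₀ ∧ ∀ r : ℝ, r₀ < r → RateTipping.RTips U f Λ r Xm Xp) := by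
  refine ⟨fun Y Yp hY hYlim hYp hne ⟨u, v, huv, hbasin⟩ => ⟨?_, ?_⟩,
    fun Yp hYp hne hbasin => ⟨?_, ?_⟩⟩
  · exact RateTipping.not_isForwardBasinStable_of_mem_basin hU hf hΛ.contDiff.continuous hX hXp hY
      hYlim hne huv hbasin
  · exact RateTipping.exists_reparametrization_rTips hU hf hΛ hX hXm hXm_attr hY hYlim hYp hne huv
      hbasin
  · exact RateTipping.not_isForwardBasinStable_of_mem_basin_limit hU hf hΛ hXm hXp hYp hne hbasin
  · exact RateTipping.exists_forall_rTips_of_mem_basin_limit hU hf hΛ hXm_attr hYp hne hbasin
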